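/- For a prime $p$ and a set $A\subset \mathrm{SL}_2(\mathbb{Z})$ let $\bar A\subset \mathrm{SL}_2(\mathbb{Z}/p\mathbb{Z})$ denote the reduction of $A$ modulo $p$. For a group $G$ and $S\subset G$, let $\Gamma(G,S)$ be the Cayley graph with vertex set $G$ and an undirected edge between $sg$ and $g$ for all $g\in G$, $s\in S$; its diameter is the maximum over all pairs of vertices of the length of a shortest path between them. Let $A\subset \mathrm{SL}_2(\mathbb{Z})$ be a set such that the subgroup $\langle A\rangle$ of $\mathrm{SL}_2(\mathbb{Z})$ generated by $A$ is a free group. Then there is a constant $C>0$, depending only on $A$, such that for every prime $p$ for which $\bar A$ generates $\mathrm{SL}_2(\mathbb{Z}/p\mathbb{Z})$, the graph $\Gamma(\mathrm{SL}_2(\mathbb{Z}/p\mathbb{Z}),\bar A)$ is connected and $$\operatorname{diam}\,\Gamma(\mathrm{SL}_2(\mathbb{Z}/p\mathbb{Z}),\bar A)\le C\log p .$$ For example, let $$A_m=\left\{\begin{pmatrix}1&m\\0&1\end{pmatrix},\begin{pmatrix}1&0\\m&1\end{pmatrix}\right\}.$$ Then $A_3$ generates a free subgroup of $\mathrm{SL}_2(\mathbb{Z})$.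 For $m=1$ and for $m=3$, the set $\bar A_m$ generates $\mathrm{SL}_2(\mathbb{Z}/p\mathbb{Z})$ for every prime $p\ge 5$, and there is a constant $C>0$ such that for every prime $p\ge 5$ the graph $\Gamma(\mathrm{SL}_2(\mathbb{Z}/p\mathbb{Z}),\bar A_m)$ is connected, with diameter at most $C\log p$. -/

import Mathlib

/-- The Cayley graph `Γ(G, A)`: the vertex set is `G`, with an (undirected) edge between `a * g` and
`g` for every `g : G` and `a ∈ A`. Loops (from `1 ∈ A`) are dropped; they do not affect distances. -/
def cayleyGraph {G : Type*} [Group G] (A : Set G) : SimpleGraph G :=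
  SimpleGraph.fromRel fun u v => ∃ a ∈ A, u = a * v

/-- Reduction modulo `p`, as a homomorphism `SL₂(ℤ) → SL₂(ℤ/pℤ)`. -/
def reductionMod (p : ℕ) :
    Matrix.SpecialLinearGroup (Fin 2) ℤ →* Matrix.SpecialLinearGroup (Fin 2) (ZMod p) :=
  Matrix.SpecialLinearGroup.map (Int.castRingHom (ZMod p))

/-- The set consisting of the two matrices `(1 m; 0 1)` and `(1 0; m 1)` of `SL₂(ℤ)`. -/
def unipotentPair (m : ℤ) : Set (Matrix.SpecialLinearGroup (Fin 2) ℤ) :=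
  {⟨!![1, m; 0, 1], by simp [Matrix.det_fin_two_of]⟩,
    ⟨!![1, 0; m, 1], by simp [Matrix.det_fin_two_of]⟩}

open Matrix
open scoped Pointwise

namespace SLTwoGrowth


/-! The proof combines logarithmic girth with Helfgott-type growth in SL₂(𝔽_p).

Girth. If the reduction of A generates, ⟨A⟩ is not commutative (`exists_noncommuting`), so the free
group ⟨A⟩ contains x, y whose positive words of equal length are distinct (`exists_free_pair`).
Words of length n have entries exponential in n, so for n up to a small multiple of log p they stay
distinct mod p. Hence a ball of radius O(log p) has at least p^δ elements, with δ independent of p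
(`exists_large_ball`).

Growth. Let A now be a symmetric generating subset of SL₂(𝔽_p) containing 1, with small tripling.
Elements of a fixed trace t, with t ≠ 0 and t² ≠ 4, number at most about |A|^(2/3)
(`card_slice_le`): triples of them are recovered, up to two choices, from their two ratios, apart
from few degenerate triples. By orbit-stabilizer, a torus meeting A⁴ in a generic element contains
at least about |A|^(1/3) elements of A² (`many_generic_commuting`). This property passes to
conjugates under A, hence to all conjugates of the torus; counting over about p² of them forces |A|
to be close to p³ (`card_group_mul_le`, `large_of_small_tripling`). So a set of size p^δ either
grows by a fixed power of p when tripled, or is so large that a bounded power is the whole group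
(`pow_eq_univ_of_large`, by sum-product for dilates of unipotents). Boundedly many triplings suffice
(`exists_pow_eq_univ`).

A bounded power of a ball of radius O(log p) is thus everything, and the finitely many small primes
only affect the constant. Freeness for m = 3 is ping-pong; m = 1 is reduced to m = 3, whose
generators are cubes of those for m = 1. -/

/-- The group `SL₂(R)`. -/
abbrev SLTwo (R : Type*) [CommRing R] := Matrix.SpecialLinearGroup (Fin 2) R

/-! ### Trace identities and the fibres of the ratio map -/

section Algebra

variable {F : Type*} [Field F]

/-- The trace of an element of `SL₂`. -/
def tr (g : SLTwo F) : F := g 0 0 + g 1 1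

/-- The matrix `m` maps the vector `e` into the line spanned by `e`. -/
def FixesLine (m : Matrix (Fin 2) (Fin 2) F) (e : Fin 2 → F) : Prop := ∃ c : F, m *ᵥ e = c • e

lemma det_eq (g : SLTwo F) :
    g 0 0 * g 1 1 - g 0 1 * g 1 0 = 1 := by
  have := g.2
  rwa [Matrix.det_fin_two] at this

lemma ext_entries {g h : SLTwo F} (h00 : g 0 0 = h 0 0)
    (h01 : g 0 1 = h 0 1) (h10 : g 1 0 = h 1 0) (h11 : g 1 1 = h 1 1) : g = h := by
  apply Subtype.ext
  ext i j
  fin_cases i <;> fin_cases j <;> assumption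

lemma mul_entry (g h : SLTwo F) (i j : Fin 2) :
    (g * h) i j = g i 0 * h 0 j + g i 1 * h 1 j := by
  rw [Matrix.SpecialLinearGroup.coe_mul, Matrix.mul_apply, Fin.sum_univ_two]

lemma inv_entries (g : SLTwo F) :
    (g⁻¹) 0 0 = g 1 1 ∧ (g⁻¹) 0 1 = -g 0 1 ∧ (g⁻¹) 1 0 = -g 1 0 ∧
      (g⁻¹) 1 1 = g 0 0 := by
  rw [Matrix.SpecialLinearGroup.coe_inv, Matrix.adjugate_fin_two]
  simp

lemma tr_mul_comm (g h : SLTwo F) : tr (g * h) = tr (h * g) := by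
  simp only [tr, mul_entry]; ring

lemma tr_conj (g h : SLTwo F) : tr (g * h * g⁻¹) = tr h := by
  rw [tr_mul_comm, inv_mul_cancel_left]

lemma fixesLine_of_cross {m : Matrix (Fin 2) (Fin 2) F} {e : Fin 2 → F} (he : e ≠ 0)
    (h : (m 0 0 * e 0 + m 0 1 * e 1) * e 1 = (m 1 0 * e 0 + m 1 1 * e 1) * e 0) :
    FixesLine m e := by
  by_cases h0 : e 0 = 0
  · have h1 : e 1 ≠ 0 := fun h1 => he (by ext i; fin_cases i <;> assumption)
    refine ⟨(m 1 0 * e 0 + m 1 1 * e 1) / e 1, ?_⟩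
    ext i
    fin_cases i
    · simp [mulVec, dotProduct, Fin.sum_univ_two, h0] at h ⊢
      tauto
    · simp [mulVec, dotProduct, Fin.sum_univ_two, h1]
  · refine ⟨(m 0 0 * e 0 + m 0 1 * e 1) / e 0, ?_⟩
    ext i
    fin_cases i
    · simp [mulVec, dotProduct, Fin.sum_univ_two, h0]
    · simp only [mulVec, dotProduct, Fin.sum_univ_two, Fin.mk_one, Pi.smul_apply, smul_eq_mul]
      field_simp
      linear_combination -h

/-- The matrix N = (a b; c −a) is nonzero with N² = 0, so its kernel and image are one line, spanned
by e. The last condition is tr(mN) = 0; writing N = e ⊗ ℓ it says ℓ(m e) = 0, that is, m e lies in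
ker ℓ, the line of e. -/
lemma exists_fixed_line_of_nilpotent {a b c : F} (h0 : ¬(a = 0 ∧ b = 0 ∧ c = 0))
    (hdet : a * a + b * c = 0) :
    ∃ e : Fin 2 → F, e ≠ 0 ∧ a * e 0 + b * e 1 = 0 ∧ c * e 0 - a * e 1 = 0 ∧
      ∀ m : Matrix (Fin 2) (Fin 2) F, m 0 0 * a + m 0 1 * c + m 1 0 * b - m 1 1 * a = 0 →
        FixesLine m e := by
  by_cases hb : b = 0
  · have ha : a = 0 := by simpa [hb] using hdet
    have hc : c ≠ 0 := by tauto
    have he : (![0, 1] : Fin 2 → F) ≠ 0 := fun h => by simpa using congrFun h 1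
    refine ⟨![0, 1], he, by simp [hb], by simp [ha], fun m hm => fixesLine_of_cross he ?_⟩
    have : m 0 1 = 0 := by simpa [ha, hb, hc] using hm
    simp [this]
  · have he : (![b, -a] : Fin 2 → F) ≠ 0 := fun h => hb (by simpa using congrFun h 0)
    refine ⟨![b, -a], he, by simp; ring, by simp; linear_combination hdet,
      fun m hm => fixesLine_of_cross he ?_⟩
    simp
    linear_combination -b * hm + m 0 1 * hdet

lemma FixesLine.mul {m n : Matrix (Fin 2) (Fin 2) F} {e : Fin 2 → F} (hm : FixesLine m e)
    (hn : FixesLine n e) : FixesLine (m * n) e := by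
  obtain ⟨c, hc⟩ := hm
  obtain ⟨d, hd⟩ := hn
  exact ⟨d * c, by rw [← mulVec_mulVec, hd, mulVec_smul, hc, smul_smul]⟩

/-- If the affine line through `x` and `x + n` meets `det = 1` in a third point, and `n` is
traceless, then `n` is nilpotent and orthogonal to `x`. -/
lemma isotropic_of_three_points {x00 x01 x10 x11 a b c s : F} (hs0 : s ≠ 0) (hs1 : s ≠ 1)
    (h0 : x00 * x11 - x01 * x10 = 1)
    (h1 : (x00 + a) * (x11 - a) - (x01 + b) * (x10 + c) = 1)
    (h2 : (x00 + s * a) * (x11 - s * a) - (x01 + s * b) * (x10 + s * c) = 1) :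
    a * a + b * c = 0 ∧ x00 * a + x01 * c + x10 * b - x11 * a = 0 := by
  have hs : s * (1 - s) ≠ 0 := mul_ne_zero hs0 (sub_ne_zero.2 hs1.symm)
  have hn : a * a + b * c = 0 := by
    have : s * (1 - s) * (a * a + b * c) = 0 := by linear_combination h2 - s * h1 - (1 - s) * h0
    exact (mul_eq_zero.1 this).resolve_left hs
  exact ⟨hn, by linear_combination -h1 + h0 - hn⟩

lemma parallel_of_cross {n u v : Fin 3 → F} (hn : n ≠ 0)
    (hu : ∀ i j, u i * n j = u j * n i) (hv : ∀ i j, v i * n j = v j * n i) :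
    ∃ β γ : F, (β ≠ 0 ∨ γ ≠ 0) ∧ ∀ i, β * u i + γ * v i = 0 := by
  obtain ⟨k, hk⟩ : ∃ k, n k ≠ 0 := by
    by_contra! h
    exact hn (funext h)
  by_cases h : u k = 0
  · refine ⟨1, 0, Or.inl one_ne_zero, fun i => ?_⟩
    have := hu i k
    rw [h, zero_mul] at this
    simpa using (mul_eq_zero.1 this).resolve_right hk
  · refine ⟨v k, -u k, Or.inr (neg_ne_zero.2 h), fun i => ?_⟩
    apply mul_right_cancel₀ hk
    linear_combination v k * hu i k - u k * hv i k

/-- Key fibre bound: if `x, y, z` are distinct elements of trace `t ≠ 0` and right translation by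
`x⁻¹ y` and `x⁻¹ z` keeps the trace `t` at three points `x, x₁, x₂` of trace `t`, then `x, y, z` have
a common eigenvector. -/
lemma exists_common_fixed_line {t : F} (ht : t ≠ 0) {x y z x₁ x₂ : SLTwo F}
    (hx : tr x = t) (hy : tr y = t) (hz : tr z = t) (hxy : x ≠ y) (hxz : x ≠ z) (hyz : y ≠ z)
    (h1 : x₁ ≠ x) (h2 : x₂ ≠ x) (h12 : x₁ ≠ x₂) (ht1 : tr x₁ = t) (ht2 : tr x₂ = t)
    (hu1 : tr (x₁ * (x⁻¹ * y)) = t) (hu2 : tr (x₂ * (x⁻¹ * y)) = t)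
    (hv1 : tr (x₁ * (x⁻¹ * z)) = t) (hv2 : tr (x₂ * (x⁻¹ * z)) = t) :
    ∃ e : Fin 2 → F, e ≠ 0 ∧ FixesLine (x : Matrix (Fin 2) (Fin 2) F) e ∧
      FixesLine (y : Matrix (Fin 2) (Fin 2) F) e ∧ FixesLine (z : Matrix (Fin 2) (Fin 2) F) e := by
  obtain ⟨u, hu⟩ : ∃ u, x⁻¹ * y = u := ⟨_, rfl⟩
  obtain ⟨v, hv⟩ : ∃ v, x⁻¹ * z = v := ⟨_, rfl⟩
  rw [hu] at hu1 hu2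
  rw [hv] at hv1 hv2
  obtain rfl : y = x * u := by rw [← hu, mul_inv_cancel_left]
  obtain rfl : z = x * v := by rw [← hv, mul_inv_cancel_left]
  clear hu hv
  simp only [tr, mul_entry] at hx hy hz ht1 ht2 hu1 hu2 hv1 hv2
  have dx := det_eq x
  have d1 := det_eq x₁
  have d2 := det_eq x₂
  have e1 : x₁ 1 1 = x 1 1 - (x₁ 0 0 - x 0 0) := by linear_combination ht1 - hx
  have e2 : x₂ 1 1 = x 1 1 - (x₂ 0 0 - x 0 0) := by linear_combination ht2 - hx
  obtain ⟨a₁, ha₁⟩ : ∃ a, a = x₁ 0 0 - x 0 0 := ⟨_, rfl⟩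
  obtain ⟨b₁, hb₁⟩ : ∃ a, a = x₁ 0 1 - x 0 1 := ⟨_, rfl⟩
  obtain ⟨c₁, hc₁⟩ : ∃ a, a = x₁ 1 0 - x 1 0 := ⟨_, rfl⟩
  obtain ⟨a₂, ha₂⟩ : ∃ a, a = x₂ 0 0 - x 0 0 := ⟨_, rfl⟩
  obtain ⟨b₂, hb₂⟩ : ∃ a, a = x₂ 0 1 - x 0 1 := ⟨_, rfl⟩
  obtain ⟨c₂, hc₂⟩ : ∃ a, a = x₂ 1 0 - x 1 0 := ⟨_, rfl⟩
  have hn1 : ¬(a₁ = 0 ∧ b₁ = 0 ∧ c₁ = 0) := by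
    rintro ⟨ha, hb, hc⟩
    refine h1 (ext_entries ?_ ?_ ?_ ?_)
    · linear_combination ha - ha₁
    · linear_combination hb - hb₁
    · linear_combination hc - hc₁
    · linear_combination e1 - ha + ha₁
  have hn2 : ¬(a₂ = 0 ∧ b₂ = 0 ∧ c₂ = 0) := by
    rintro ⟨ha, hb, hc⟩
    refine h2 (ext_entries ?_ ?_ ?_ ?_)
    · linear_combination ha - ha₂
    · linear_combination hb - hb₂
    · linear_combination hc - hc₂
    · linear_combination e2 - ha + ha₂
  -- The traceless displacements x₁ − x and x₂ − x are trace-orthogonal to u and to v.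
  have ou1 : a₁ * (u 0 0 - u 1 1) + b₁ * u 1 0 + c₁ * u 0 1 = 0 := by
    rw [ha₁, hb₁, hc₁]; linear_combination hu1 - hy - u 1 1 * e1
  have ou2 : a₂ * (u 0 0 - u 1 1) + b₂ * u 1 0 + c₂ * u 0 1 = 0 := by
    rw [ha₂, hb₂, hc₂]; linear_combination hu2 - hy - u 1 1 * e2
  have ov1 : a₁ * (v 0 0 - v 1 1) + b₁ * v 1 0 + c₁ * v 0 1 = 0 := by
    rw [ha₁, hb₁, hc₁]; linear_combination hv1 - hz - v 1 1 * e1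
  have ov2 : a₂ * (v 0 0 - v 1 1) + b₂ * v 1 0 + c₂ * v 0 1 = 0 := by
    rw [ha₂, hb₂, hc₂]; linear_combination hv2 - hz - v 1 1 * e2
  -- The vector is the cross product of the two displacements. If it vanishes, x, x₁, x₂ are
  -- collinear, so their direction is nilpotent and orthogonal to x, u and v: its kernel is the
  -- common eigenline.
  by_cases hN : (![b₁ * c₂ - c₁ * b₂, c₁ * a₂ - a₁ * c₂, a₁ * b₂ - b₁ * a₂] : Fin 3 → F) = 0
  · have n0 : b₁ * c₂ - c₁ * b₂ = 0 := congrFun hN 0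
    have n1 : c₁ * a₂ - a₁ * c₂ = 0 := congrFun hN 1
    have n2 : a₁ * b₂ - b₁ * a₂ = 0 := congrFun hN 2
    obtain ⟨s, hsa, hsb, hsc⟩ : ∃ s, a₂ = s * a₁ ∧ b₂ = s * b₁ ∧ c₂ = s * c₁ := by
      by_cases ha : a₁ = 0
      · by_cases hb : b₁ = 0
        · have hc : c₁ ≠ 0 := by tauto
          refine ⟨c₂ / c₁, ?_, ?_, ?_⟩ <;> field_simp
          · linear_combination n1
          · linear_combination -n0
        · refine ⟨b₂ / b₁, ?_, ?_, ?_⟩ <;> field_simp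
          · linear_combination -n2
          · linear_combination n0
      · refine ⟨a₂ / a₁, ?_, ?_, ?_⟩ <;> field_simp
        · linear_combination n2
        · linear_combination -n1
    have hs0 : s ≠ 0 := by
      rintro rfl
      exact hn2 ⟨by simpa using hsa, by simpa using hsb, by simpa using hsc⟩
    have hs1 : s ≠ 1 := by
      rintro rfl
      rw [one_mul] at hsa hsb hsc
      refine h12 (ext_entries ?_ ?_ ?_ ?_)
      · linear_combination -ha₁ + ha₂ - hsa
      · linear_combination -hb₁ + hb₂ - hsb
      · linear_combination -hc₁ + hc₂ - hsc
      · linear_combination e1 - e2 + ha₁ - ha₂ + hsa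
    obtain ⟨hnil, horth⟩ := isotropic_of_three_points (a := a₁) (b := b₁) (c := c₁) hs0 hs1 dx
      (by rw [ha₁, hb₁, hc₁]; linear_combination d1 - x₁ 0 0 * e1)
      (by rw [← hsa, ← hsb, ← hsc, ha₂, hb₂, hc₂]; linear_combination d2 - x₂ 0 0 * e2)
    obtain ⟨e, he, -, -, hfix⟩ := exists_fixed_line_of_nilpotent hn1 hnil
    have fx := hfix x horth
    have fu := hfix u (by linear_combination ou1)
    have fv := hfix v (by linear_combination ov1)
    refine ⟨e, he, fx, ?_, ?_⟩
    · rw [Matrix.SpecialLinearGroup.coe_mul]; exact fx.mul fu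
    · rw [Matrix.SpecialLinearGroup.coe_mul]; exact fx.mul fv
  · have cross : ∀ w : SLTwo F, a₁ * (w 0 0 - w 1 1) + b₁ * w 1 0 + c₁ * w 0 1 = 0 →
        a₂ * (w 0 0 - w 1 1) + b₂ * w 1 0 + c₂ * w 0 1 = 0 → ∀ i j,
        (![w 0 0 - w 1 1, w 1 0, w 0 1] : Fin 3 → F) i *
          (![b₁ * c₂ - c₁ * b₂, c₁ * a₂ - a₁ * c₂, a₁ * b₂ - b₁ * a₂] : Fin 3 → F) j =
        (![w 0 0 - w 1 1, w 1 0, w 0 1] : Fin 3 → F) j *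
          (![b₁ * c₂ - c₁ * b₂, c₁ * a₂ - a₁ * c₂, a₁ * b₂ - b₁ * a₂] : Fin 3 → F) i := by
      intro w o1 o2 i j
      fin_cases i <;> fin_cases j <;> simp
      · linear_combination c₁ * o2 - c₂ * o1
      · linear_combination -b₁ * o2 + b₂ * o1
      · linear_combination -c₁ * o2 + c₂ * o1
      · linear_combination a₁ * o2 - a₂ * o1
      · linear_combination b₁ * o2 - b₂ * o1
      · linear_combination -a₁ * o2 + a₂ * o1
    -- Otherwise the traceless parts of u and v are both multiples of the cross product, so α + βu +
    -- γv = 0, whence αx + βy + γz = 0. Taking traces, t ≠ 0 gives α + β + γ = 0: now x, y, z are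
    -- collinear.
    obtain ⟨β, γ, hβγ, hpar⟩ := parallel_of_cross hN (cross u ou1 ou2) (cross v ov1 ov2)
    have p0 : β * (u 0 0 - u 1 1) + γ * (v 0 0 - v 1 1) = 0 := hpar 0
    have p1 : β * u 1 0 + γ * v 1 0 = 0 := hpar 1
    have p2 : β * u 0 1 + γ * v 0 1 = 0 := hpar 2
    obtain ⟨α, hα⟩ : ∃ α, α = -(β * u 0 0 + γ * v 0 0) := ⟨_, rfl⟩
    have hsum : α + β + γ = 0 := by
      have : (α + β + γ) * t = 0 := by
        linear_combination (-α) * hx - β * hy - γ * hz + (x 0 0 + x 1 1) * hα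
          + x 0 1 * p1 + x 1 0 * p2 - x 1 1 * p0
      exact (mul_eq_zero.1 this).resolve_right ht
    have one : ∀ w : SLTwo F, w 0 0 = 1 → w 0 1 = 0 → w 1 0 = 0 → w 1 1 = 1 → x * w = x := by
      intro w h00 h01 h10 h11
      have : w = 1 := ext_entries (by simpa using h00) (by simpa using h01) (by simpa using h10)
        (by simpa using h11)
      rw [this, mul_one]
    have hγ : γ ≠ 0 := by
      rintro rfl
      have hβ : β ≠ 0 := by simpa using hβγ
      refine hxy (one u ?_ ?_ ?_ ?_).symm <;> apply mul_left_cancel₀ hβ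
      · linear_combination -hsum + hα
      · linear_combination p2
      · linear_combination p1
      · linear_combination -hsum + hα - p0
    have hβ : β ≠ 0 := by
      rintro rfl
      refine hxz (one v ?_ ?_ ?_ ?_).symm <;> apply mul_left_cancel₀ hγ
      · linear_combination -hsum + hα
      · linear_combination p2
      · linear_combination p1
      · linear_combination -hsum + hα - p0
    have hs1 : -β / γ ≠ 1 := by
      intro h
      rw [div_eq_iff hγ] at h
      refine hyz (congrArg (x * ·) (ext_entries ?_ ?_ ?_ ?_)) <;> apply mul_left_cancel₀ hβ
      · linear_combination hα - hsum + v 0 0 * h - h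
      · linear_combination p2 + v 0 1 * h
      · linear_combination p1 + v 1 0 * h
      · linear_combination hα - hsum + v 1 1 * h - h - p0
    have dy := det_eq (x * u)
    have dz := det_eq (x * v)
    have zy : ∀ i j, (x * v) i j = x i j + -β / γ * ((x * u) i j - x i j) := by
      intro i j
      rw [mul_entry, mul_entry]
      field_simp
      fin_cases j <;> simp
      · linear_combination x i 0 * (hα - hsum) + x i 1 * p1
      · linear_combination x i 0 * p2 + x i 1 * (hα - hsum - p0)
    have ey : (x * u) 1 1 = x 1 1 - ((x * u) 0 0 - x 0 0) := by
      rw [mul_entry, mul_entry]; linear_combination hy - hx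
    have hs0 : -β / γ ≠ 0 := div_ne_zero (neg_ne_zero.2 hβ) hγ
    generalize -β / γ = s at hs0 hs1 zy
    obtain ⟨a, ha⟩ : ∃ a, a = (x * u) 0 0 - x 0 0 := ⟨_, rfl⟩
    obtain ⟨b, hb⟩ : ∃ a, a = (x * u) 0 1 - x 0 1 := ⟨_, rfl⟩
    obtain ⟨c, hc⟩ : ∃ a, a = (x * u) 1 0 - x 1 0 := ⟨_, rfl⟩
    have hn : ¬(a = 0 ∧ b = 0 ∧ c = 0) := by
      rintro ⟨ha', hb', hc'⟩
      refine hxy.symm (ext_entries ?_ ?_ ?_ ?_)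
      · linear_combination ha' - ha
      · linear_combination hb' - hb
      · linear_combination hc' - hc
      · linear_combination ey - ha' + ha
    have z00 : (x * v) 0 0 = x 0 0 + s * a := by rw [ha]; exact zy 0 0
    have z01 : (x * v) 0 1 = x 0 1 + s * b := by rw [hb]; exact zy 0 1
    have z10 : (x * v) 1 0 = x 1 0 + s * c := by rw [hc]; exact zy 1 0
    have z11 : (x * v) 1 1 = x 1 1 - s * a := by
      rw [ha, zy 1 1, ey]; ring
    obtain ⟨hnil, horth⟩ := isotropic_of_three_points (a := a) (b := b) (c := c) hs0 hs1 dx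
      (by rw [ha, hb, hc]; linear_combination dy - (x * u) 0 0 * ey)
      (by rw [← z00, ← z01, ← z10, ← z11]; exact dz)
    obtain ⟨e, he, -, -, hfix⟩ := exists_fixed_line_of_nilpotent hn hnil
    refine ⟨e, he, hfix x horth, hfix _ ?_, hfix _ ?_⟩
    · have y00 : (x * u) 0 0 = x 0 0 + a := by rw [ha]; ring
      have y01 : (x * u) 0 1 = x 0 1 + b := by rw [hb]; ring
      have y10 : (x * u) 1 0 = x 1 0 + c := by rw [hc]; ring
      rw [ey, ← ha, y00, y01, y10]
      linear_combination horth + 2 * hnil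
    · rw [z00, z01, z10, z11]
      linear_combination horth + 2 * s * hnil

end Algebra


/-! ### The action on vectors: stabilizers and eigenlines -/

section Action

variable {F : Type*} [Field F]

/-- The action of `SL₂(F)` on column vectors. -/
def act (g : SLTwo F) (e : Fin 2 → F) : Fin 2 → F := (g : Matrix (Fin 2) (Fin 2) F) *ᵥ e

/-- The determinant of two vectors. -/
def area (e f : Fin 2 → F) : F := e 0 * f 1 - e 1 * f 0

lemma act_zero (g : SLTwo F) (e : Fin 2 → F) : act g e 0 = g 0 0 * e 0 + g 0 1 * e 1 := by
  simp [act, mulVec, dotProduct, Fin.sum_univ_two]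

lemma act_one_apply (g : SLTwo F) (e : Fin 2 → F) : act g e 1 = g 1 0 * e 0 + g 1 1 * e 1 := by
  simp [act, mulVec, dotProduct, Fin.sum_univ_two]

lemma act_mul (g h : SLTwo F) (e : Fin 2 → F) : act (g * h) e = act g (act h e) := by
  rw [act, act, act, mulVec_mulVec, Matrix.SpecialLinearGroup.coe_mul]

lemma one_entry_00 : (1 : SLTwo F) 0 0 = 1 := by simp
lemma one_entry_01 : (1 : SLTwo F) 0 1 = 0 := by simp
lemma one_entry_10 : (1 : SLTwo F) 1 0 = 0 := by simp
lemma one_entry_11 : (1 : SLTwo F) 1 1 = 1 := by simp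

lemma one_act (e : Fin 2 → F) : act 1 e = e := by simp [act]

lemma act_smul (g : SLTwo F) (c : F) (e : Fin 2 → F) : act g (c • e) = c • act g e :=
  mulVec_smul _ _ _

lemma act_inv_eq {g : SLTwo F} {e f : Fin 2 → F} (h : act g e = f) : act g⁻¹ f = e := by
  rw [← h, ← act_mul, inv_mul_cancel, one_act]

lemma area_act (g : SLTwo F) (e f : Fin 2 → F) : area (act g e) (act g f) = area e f := by
  simp only [area, act_zero, act_one_apply]
  linear_combination (e 0 * f 1 - e 1 * f 0) * det_eq g

lemma eq_zero_of_area {d e f : Fin 2 → F} (hef : area f e ≠ 0) (h1 : area d e = 0)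
    (h2 : area d f = 0) : d = 0 := by
  simp only [area] at *
  ext i
  apply mul_left_cancel₀ hef
  fin_cases i <;> simp only [Pi.zero_apply, mul_zero, Fin.zero_eta, Fin.mk_one]
  · linear_combination f 0 * h1 - e 0 * h2
  · linear_combination f 1 * h1 - e 1 * h2

lemma eq_one_of_act {g : SLTwo F} {e f : Fin 2 → F} (hef : area f e ≠ 0) (he : act g e = e)
    (hf : act g f = f) : g = 1 := by
  have e0 := congrFun he 0
  have e1 := congrFun he 1
  have f0 := congrFun hf 0
  have f1 := congrFun hf 1
  rw [act_zero] at e0 f0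
  rw [act_one_apply] at e1 f1
  simp only [area] at hef
  apply ext_entries <;> apply mul_left_cancel₀ hef <;>
    simp only [one_entry_00, one_entry_01, one_entry_10, one_entry_11]
  · linear_combination e 1 * f0 - f 1 * e0
  · linear_combination f 0 * e0 - e 0 * f0
  · linear_combination e 1 * f1 - f 1 * e1
  · linear_combination f 0 * e1 - e 0 * f1

/-- An element fixing f preserves `area · f`, so it moves e by a multiple of f; that multiple, read
off from the area of the image with e, determines it. -/
lemma eq_of_area_act_eq {v w : SLTwo F} {e f : Fin 2 → F} (hef : area f e ≠ 0) (hv : act v f = f)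
    (hw : act w f = f) (h : area (act v e) e = area (act w e) e) : v = w := by
  have h1 : area (act v e) f = area e f := by
    conv_lhs => rw [← hv]
    exact area_act _ _ _
  have h2 : area (act w e) f = area e f := by
    conv_lhs => rw [← hw]
    exact area_act _ _ _
  have hd : act v e - act w e = 0 := by
    apply eq_zero_of_area hef
    · simp only [area, Pi.sub_apply] at *
      linear_combination h
    · simp only [area, Pi.sub_apply] at *
      linear_combination h1 - h2
  have : w⁻¹ * v = 1 := by
    apply eq_one_of_act hef
    · rw [act_mul, sub_eq_zero.1 hd]; exact act_inv_eq rfl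
    · rw [act_mul, hv]; exact act_inv_eq hw
  exact (inv_mul_eq_one.1 this).symm

lemma fixesLine_iff {g : SLTwo F} {e : Fin 2 → F} :
    FixesLine (g : Matrix (Fin 2) (Fin 2) F) e ↔ ∃ c : F, act g e = c • e := Iff.rfl

lemma fixesLine_of_area {g : SLTwo F} {e : Fin 2 → F} (he : e ≠ 0) (h : area (act g e) e = 0) :
    FixesLine (g : Matrix (Fin 2) (Fin 2) F) e := by
  apply fixesLine_of_cross he
  simp only [area, act_zero, act_one_apply] at h
  linear_combination h

lemma exists_eq_smul_of_area {e f : Fin 2 → F} (he : e ≠ 0) (h : area f e = 0) :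
    ∃ c : F, f = c • e := by
  simp only [area] at h
  by_cases h0 : e 0 = 0
  · have h1 : e 1 ≠ 0 := fun h1 => he (by ext i; fin_cases i <;> assumption)
    refine ⟨f 1 / e 1, ?_⟩
    ext i
    fin_cases i
    · simp [h0, h1] at h ⊢; exact h
    · simp [h1]
  · refine ⟨f 0 / e 0, ?_⟩
    ext i
    fin_cases i
    · simp [h0]
    · simp only [Fin.mk_one, Pi.smul_apply, smul_eq_mul]
      field_simp
      linear_combination -h

/-- If the products `u₁ v u₃`, where `u₁, u₃` fix `e` and `v ≠ 1` fixes `f`, agree, so do their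
factors. -/
lemma factors_eq {a b v w : SLTwo F} {e f : Fin 2 → F} (hef : area f e ≠ 0)
    (ha : act a e = e) (hb : act b e = e) (hv : act v f = f) (hw : act w f = f) (hv1 : v ≠ 1)
    (h : a * v * b = w) : a = 1 ∧ v = w ∧ b = 1 := by
  -- As a and b fix e, they do not change the area of the image of e with e: the product already
  -- determines v.
  have hvw : v = w := by
    apply eq_of_area_act_eq hef hv hw
    calc area (act v e) e = area (act a (act v e)) (act a e) := (area_act ..).symm
      _ = area (act w e) e := by rw [ha, ← h, act_mul, act_mul, hb]
  have ha1 : a = 1 := by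
    have hve : area (act v e) e ≠ 0 := by
      intro h0
      apply hv1
      apply eq_of_area_act_eq hef hv (one_act f)
      rw [h0, one_act]; simp [area]; ring
    apply eq_one_of_act hve ha
    have : act (a * v * b) e = act v e := by rw [h, hvw]
    rwa [act_mul, act_mul, hb] at this
  refine ⟨ha1, hvw, ?_⟩
  rw [ha1, one_mul, hvw] at h
  simpa using h

/-- The stabilizer of a line is a subgroup, and the two elementary unipotents have no common
eigenline. -/
lemma exists_not_fixesLine {A : Set (SLTwo F)} (hA : Subgroup.closure A = ⊤)
    {e : Fin 2 → F} (he : e ≠ 0) :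
    ∃ g ∈ A, ¬ FixesLine (g : Matrix (Fin 2) (Fin 2) F) e := by
  by_contra! hall
  have key : ∀ g : SLTwo F, FixesLine (g : Matrix (Fin 2) (Fin 2) F) e := by
    intro g
    have hg : g ∈ Subgroup.closure A := by rw [hA]; trivial
    induction hg using Subgroup.closure_induction with
    | mem x hx => exact hall x hx
    | one => exact ⟨1, by simp⟩
    | mul x y _ _ hx hy => rw [Matrix.SpecialLinearGroup.coe_mul]; exact hx.mul hy
    | inv x _ hx =>
      obtain ⟨c, hc⟩ := fixesLine_iff.1 hx
      have h1 := act_inv_eq hc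
      rw [act_smul] at h1
      have hc0 : c ≠ 0 := by
        rintro rfl
        rw [zero_smul] at h1
        exact he h1.symm
      exact fixesLine_iff.2 ⟨c⁻¹, by rw [← h1, smul_smul, h1, inv_mul_cancel₀ hc0, one_smul]⟩
  obtain ⟨c, hc⟩ := fixesLine_iff.1 (key ⟨!![1, 1; 0, 1], by simp [Matrix.det_fin_two_of]⟩)
  obtain ⟨d, hd⟩ := fixesLine_iff.1 (key ⟨!![1, 0; 1, 1], by simp [Matrix.det_fin_two_of]⟩)
  have c0 := (act_zero _ e).symm.trans (congrFun hc 0)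
  have c1 := (act_one_apply _ e).symm.trans (congrFun hc 1)
  have d0 := (act_zero _ e).symm.trans (congrFun hd 0)
  have d1 := (act_one_apply _ e).symm.trans (congrFun hd 1)
  simp at c0 c1 d0 d1
  apply he
  ext i
  fin_cases i
  · have : e 0 * e 0 = 0 := by linear_combination e 0 * d1 - e 1 * d0
    simpa using this
  · have : e 1 * e 1 = 0 := by linear_combination e 1 * c0 - e 0 * c1
    simpa using this

lemma eigenvalue_root {x : SLTwo F} {e : Fin 2 → F} {c : F} (he : e ≠ 0) (h : act x e = c • e) :
    1 * c ^ 2 + (-tr x) * c + 1 = 0 := by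
  have h0 := congrFun h 0
  have h1 := congrFun h 1
  rw [act_zero] at h0
  rw [act_one_apply] at h1
  simp only [Pi.smul_apply, smul_eq_mul] at h0 h1
  have k0 : (1 * c ^ 2 + (-tr x) * c + 1) * e 0 = 0 := by
    simp only [tr]
    linear_combination (x 1 1 - c) * h0 - x 0 1 * h1 - e 0 * det_eq x
  have k1 : (1 * c ^ 2 + (-tr x) * c + 1) * e 1 = 0 := by
    simp only [tr]
    linear_combination (x 0 0 - c) * h1 - x 1 0 * h0 - e 1 * det_eq x
  by_contra hne
  apply he
  ext i
  fin_cases i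
  · exact (mul_eq_zero.1 k0).resolve_left hne
  · exact (mul_eq_zero.1 k1).resolve_left hne

/-- Independent eigenvectors for one eigenvalue c would make x scalar, with c² = 1 and hence squared
trace 4. -/
lemma eigenvectors_parallel {x : SLTwo F} {e f : Fin 2 → F} {c : F} (hx : tr x ^ 2 ≠ 4)
    (he : e ≠ 0) (h : act x e = c • e) (h' : act x f = c • f) : ∃ k : F, f = k • e := by
  apply exists_eq_smul_of_area he
  by_contra hef
  have e0 := congrFun h 0
  have e1 := congrFun h 1
  have f0 := congrFun h' 0
  have f1 := congrFun h' 1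
  rw [act_zero] at e0 f0
  rw [act_one_apply] at e1 f1
  simp only [Pi.smul_apply, smul_eq_mul] at e0 e1 f0 f1
  simp only [area] at hef
  have k00 : x 0 0 = c := by
    apply mul_left_cancel₀ hef; linear_combination e 1 * f0 - f 1 * e0
  have k01 : x 0 1 = 0 := by
    apply mul_left_cancel₀ hef; linear_combination f 0 * e0 - e 0 * f0
  have k11 : x 1 1 = c := by
    apply mul_left_cancel₀ hef; linear_combination f 0 * e1 - e 0 * f1
  have hd := det_eq x
  rw [k00, k01, k11] at hd
  apply hx
  rw [tr, k00, k11]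
  linear_combination 4 * hd

lemma FixesLine.smul {g : SLTwo F} {e : Fin 2 → F} {k : F}
    (h : FixesLine (g : Matrix (Fin 2) (Fin 2) F) (k • e)) (hk : k ≠ 0) :
    FixesLine (g : Matrix (Fin 2) (Fin 2) F) e := by
  obtain ⟨c, hc⟩ := fixesLine_iff.1 h
  rw [act_smul, smul_comm] at hc
  exact fixesLine_iff.2 ⟨c, smul_right_injective _ hk hc⟩

end Action

/-! ### Few elements of a slowly growing set fix a vector -/

section Counting

variable {F : Type*} [Field F] [Fintype F] [DecidableEq F]

lemma card_quadratic_roots_le (a b c : F) (ha : a ≠ 0) :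
    (Finset.univ.filter fun x : F => a * x ^ 2 + b * x + c = 0).card ≤ 2 := by
  by_contra! h
  obtain ⟨x, hx, y, hy, z, hz, hxy, hxz, hyz⟩ := Finset.two_lt_card.1 h
  simp only [Finset.mem_filter, Finset.mem_univ, true_and] at hx hy hz
  have h1 : a * (x + y) + b = 0 := by
    apply mul_left_cancel₀ (sub_ne_zero.2 hxy); linear_combination hx - hy
  have h2 : a * (x + z) + b = 0 := by
    apply mul_left_cancel₀ (sub_ne_zero.2 hxz); linear_combination hx - hz
  have h3 : a * (y - z) = 0 := by linear_combination h1 - h2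
  rcases mul_eq_zero.1 h3 with h | h
  · exact ha h
  · exact hyz (sub_eq_zero.1 h)

omit [Fintype F] in
/-- Few elements of a growing set fix a given vector. -/
lemma card_stabilizer_le {A : Finset (SLTwo F)} (hinv : A⁻¹ = A)
    (hgen : Subgroup.closure (A : Set (SLTwo F)) = ⊤) {e : Fin 2 → F} (he : e ≠ 0) :
    ((A ^ 2).filter fun g => act g e = e).card * ((A ^ 2).filter fun g => act g e = e).card *
      (((A ^ 2).filter fun g => act g e = e).card - 1) ≤ (A ^ 8).card := by
  obtain ⟨g, hgA, hg⟩ := exists_not_fixesLine hgen he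
  set U := (A ^ 2).filter fun g => act g e = e with hU
  have hgi : g⁻¹ ∈ A := by rw [← hinv]; simpa using hgA
  have hef : area (act g e) e ≠ 0 := fun h => hg (fixesLine_of_area he h)
  -- Big-cell map: conjugation by g carries U to elements fixing `act g e`, independent of e, so
  -- `factors_eq` gives injectivity. The length is 2 + (1 + 2 + 1) + 2 = 8.
  have hmaps : ∀ q ∈ (U ×ˢ (U.erase 1)) ×ˢ U, q.1.1 * (g * q.1.2 * g⁻¹) * q.2 ∈ A ^ 8 := by
    rintro ⟨⟨a, b⟩, c⟩ hq
    simp only [Finset.mem_product, Finset.mem_erase, hU, Finset.mem_filter] at hq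
    obtain ⟨⟨⟨ha, -⟩, ⟨-, ⟨hb, -⟩⟩⟩, hc, -⟩ := hq
    have : A ^ 8 = A ^ 2 * (A * A ^ 2 * A) * A ^ 2 := by
      simp only [← pow_succ, ← pow_succ', ← pow_add]
    rw [this]
    exact Finset.mul_mem_mul (Finset.mul_mem_mul ha (Finset.mul_mem_mul
      (Finset.mul_mem_mul hgA hb) hgi)) hc
  have hinj : Set.InjOn (fun q : (SLTwo F × SLTwo F) × SLTwo F =>
      q.1.1 * (g * q.1.2 * g⁻¹) * q.2) ((U ×ˢ (U.erase 1)) ×ˢ U : Finset _) := by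
    rintro ⟨⟨a, b⟩, c⟩ hq ⟨⟨a', b'⟩, c'⟩ hq' heq
    simp only [Finset.coe_product, Set.mem_prod, Finset.mem_coe, Finset.mem_erase, hU,
      Finset.mem_filter] at hq hq'
    obtain ⟨⟨⟨-, ha⟩, ⟨hb1, ⟨-, hb⟩⟩⟩, -, hc⟩ := hq
    obtain ⟨⟨⟨-, ha'⟩, ⟨hb1', ⟨-, hb'⟩⟩⟩, -, hc'⟩ := hq'
    have fixf : ∀ b : SLTwo F, act b e = e → act (g * b * g⁻¹) (act g e) = act g e := by
      intro b hb
      rw [act_mul, act_mul, act_inv_eq rfl, hb]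
    obtain ⟨h1, h2, h3⟩ := factors_eq (a := a'⁻¹ * a) (b := c * c'⁻¹) (v := g * b * g⁻¹)
      (w := g * b' * g⁻¹) hef
      (by rw [act_mul, ha, act_inv_eq ha']) (by rw [act_mul, act_inv_eq hc', hc])
      (fixf b hb) (fixf b' hb') (by simpa using hb1)
      (by
        simp only at heq
        calc a'⁻¹ * a * (g * b * g⁻¹) * (c * c'⁻¹)
            = a'⁻¹ * (a * (g * b * g⁻¹) * c) * c'⁻¹ := by group
          _ = g * b' * g⁻¹ := by rw [heq]; group)
    have h1' : a = a' := (inv_mul_eq_one.1 h1).symm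
    have h2' : b = b' := by simpa using h2
    have h3' : c = c' := mul_inv_eq_one.1 h3
    rw [h1', h2', h3']
  have := Finset.card_le_card_of_injOn _ hmaps hinj
  rw [Finset.card_product, Finset.card_product] at this
  have h1 : U.card - 1 ≤ (U.erase 1).card := Finset.pred_card_le_card_erase
  calc U.card * U.card * (U.card - 1) = U.card * (U.card - 1) * U.card := by ring
    _ ≤ U.card * (U.erase 1).card * U.card := by gcongr
    _ ≤ _ := this

end Counting


/-! ### The dimensional estimate for elements of fixed trace -/

section Slice

variable {F : Type*} [Field F] [DecidableEq F]

/-- Elements of a slice with a prescribed eigenvector and eigenvalue. -/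
lemma card_eigen_le {A S : Finset (SLTwo F)} (hinv : A⁻¹ = A) (hS : S ⊆ A) (e : Fin 2 → F)
    (c : F) : (S.filter fun y => act y e = c • e).card ≤
      ((A ^ 2).filter fun g => act g e = e).card := by
  rcases (S.filter fun y => act y e = c • e).eq_empty_or_nonempty with h | ⟨y₀, hy₀⟩
  · simp [h]
  apply Finset.card_le_card_of_injOn (fun y => y₀⁻¹ * y)
  · intro y hy
    simp only [Finset.coe_filter, Set.mem_ofPred_eq, Finset.mem_filter] at hy hy₀ ⊢
    refine ⟨?_, by rw [act_mul, hy.2, ← hy₀.2, act_inv_eq rfl]⟩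
    rw [pow_two]
    refine Finset.mul_mem_mul ?_ (hS hy.1)
    rw [← hinv]
    exact Finset.inv_mem_inv (hS hy₀.1)
  · intro a _ b _ h
    exact mul_left_cancel h

variable [Fintype F]

-- The eigenvalue on e is a root of X² − tX + 1, so it takes at most two values, and `card_eigen_le`
-- bounds each.
open Classical in
lemma card_fixesLine_le {A S : Finset (SLTwo F)} (hinv : A⁻¹ = A) (hS : S ⊆ A) {t : F}
    (hSt : ∀ g ∈ S, tr g = t) {e : Fin 2 → F} (he : e ≠ 0) :
    (S.filter fun y : SLTwo F => FixesLine (y : Matrix (Fin 2) (Fin 2) F) e).card ≤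
      2 * ((A ^ 2).filter fun g => act g e = e).card := by
  set R := Finset.univ.filter fun c : F => 1 * c ^ 2 + (-t) * c + 1 = 0 with hR
  have hsub : (S.filter fun y : SLTwo F => FixesLine (y : Matrix (Fin 2) (Fin 2) F) e) ⊆
      R.biUnion fun c => S.filter fun y => act y e = c • e := by
    intro y hy
    rw [Finset.mem_filter] at hy
    obtain ⟨c, hc⟩ := fixesLine_iff.1 hy.2
    rw [Finset.mem_biUnion]
    refine ⟨c, ?_, Finset.mem_filter.2 ⟨hy.1, hc⟩⟩
    simp only [hR, Finset.mem_filter, Finset.mem_univ, true_and]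
    rw [← hSt y hy.1]
    exact eigenvalue_root he hc
  calc _ ≤ _ := Finset.card_le_card hsub
    _ ≤ R.card * _ := Finset.card_biUnion_le_card_mul _ _ _ fun c _ => card_eigen_le hinv hS e c
    _ ≤ _ := by
      gcongr
      exact card_quadratic_roots_le _ _ _ one_ne_zero

-- An element x of trace t has at most one eigenline per root of X² − tX + 1, because t² ≠ 4. The
-- triple is then given by x, a root, and two elements of S preserving that line.
open Classical in
lemma card_common_fixed_line_le {A S : Finset (SLTwo F)} (hinv : A⁻¹ = A) (hS : S ⊆ A) {t : F}
    (ht : t ^ 2 ≠ 4) (hSt : ∀ g ∈ S, tr g = t) {M : ℕ}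
    (hM : ∀ e : Fin 2 → F, e ≠ 0 → ((A ^ 2).filter fun g => act g e = e).card ≤ M) :
    ((S ×ˢ S ×ˢ S).filter fun q => ∃ e : Fin 2 → F, e ≠ 0 ∧
      FixesLine (q.1 : Matrix (Fin 2) (Fin 2) F) e ∧
      FixesLine (q.2.1 : Matrix (Fin 2) (Fin 2) F) e ∧
      FixesLine (q.2.2 : Matrix (Fin 2) (Fin 2) F) e).card ≤ S.card * 2 * (2 * M) ^ 2 := by
  set R := Finset.univ.filter fun c : F => 1 * c ^ 2 + (-t) * c + 1 = 0 with hR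
  have hRc : R.card ≤ 2 := card_quadratic_roots_le _ _ _ one_ne_zero
  have hex : ∀ q : SLTwo F × F, ∃ e : Fin 2 → F, (e ≠ 0 ∧ act q.1 e = q.2 • e) ∨
      ¬∃ e : Fin 2 → F, e ≠ 0 ∧ act q.1 e = q.2 • e := by
    intro q
    by_cases h : ∃ e : Fin 2 → F, e ≠ 0 ∧ act q.1 e = q.2 • e
    · exact ⟨h.choose, Or.inl h.choose_spec⟩
    · exact ⟨0, Or.inr h⟩
  choose ev hev using hex
  let E (q : SLTwo F × F) : Finset (SLTwo F) :=
    if ev q = 0 then ∅ else S.filter fun y : SLTwo F => FixesLine (y : Matrix (Fin 2) (Fin 2) F) (ev q)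
  have hE : ∀ q, (E q).card ≤ 2 * M := by
    intro q
    by_cases h : ev q = 0
    · simp [E, h]
    · simp only [E, h, if_false]
      exact (card_fixesLine_le hinv hS hSt h).trans (Nat.mul_le_mul_left _ (hM _ h))
  refine (Finset.card_le_card (t := (S ×ˢ R).biUnion fun q => {q.1} ×ˢ E q ×ˢ E q) ?_).trans ?_
  · rintro ⟨x, y, z⟩ hq
    simp only [Finset.mem_filter, Finset.mem_product] at hq
    obtain ⟨⟨hx, hy, hz⟩, e, he, fx, fy, fz⟩ := hq
    obtain ⟨c, hc⟩ := fixesLine_iff.1 fx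
    have hcR : c ∈ R := by
      simp only [hR, Finset.mem_filter, Finset.mem_univ, true_and]
      rw [← hSt x hx]
      exact eigenvalue_root he hc
    rcases hev (x, c) with ⟨h0, h1⟩ | h
    · obtain ⟨k, rfl⟩ := eigenvectors_parallel (by rw [hSt x hx]; exact ht) h0 h1 hc
      have hk : k ≠ 0 := by rintro rfl; simp at he
      simp only [Finset.mem_biUnion, Finset.mem_product, Finset.mem_singleton]
      refine ⟨(x, c), ⟨hx, hcR⟩, rfl, ?_, ?_⟩ <;> simp only [E, h0, if_false, Finset.mem_filter]
      · exact ⟨hy, fy.smul hk⟩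
      · exact ⟨hz, fz.smul hk⟩
    · exact absurd ⟨e, he, hc⟩ h
  · calc _ ≤ (S ×ˢ R).card * (2 * M) ^ 2 := by
          apply Finset.card_biUnion_le_card_mul
          intro q _
          rw [Finset.card_product, Finset.card_product, Finset.card_singleton, one_mul, pow_two]
          exact Nat.mul_le_mul (hE q) (hE q)
      _ ≤ _ := by
        rw [Finset.card_product]
        gcongr

/-- Elements of a given trace: the triples of such elements are mostly determined, up to two
choices, by their ratios. -/
lemma card_slice_cube_le {A S : Finset (SLTwo F)} (hinv : A⁻¹ = A) (hS : S ⊆ A) {t : F}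
    (ht0 : t ≠ 0) (ht : t ^ 2 ≠ 4) (hSt : ∀ g ∈ S, tr g = t) {M : ℕ}
    (hM : ∀ e : Fin 2 → F, e ≠ 0 → ((A ^ 2).filter fun g => act g e = e).card ≤ M) :
    S.card ^ 3 ≤ 3 * S.card ^ 2 + S.card * 2 * (2 * M) ^ 2 + 2 * (A ^ 2).card ^ 2 := by
  classical
  let T := S ×ˢ S ×ˢ S
  -- Triples with a repetition, those with a common eigenline, and the rest, on which taking ratios
  -- into A² × A² is at most two-to-one.
  let T₁ := ((S ×ˢ S).image fun q => (q.1, q.1, q.2)) ∪ ((S ×ˢ S).image fun q => (q.1, q.2, q.1)) ∪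
    ((S ×ˢ S).image fun q => (q.1, q.2, q.2))
  let T₂ := T.filter fun q => ∃ e : Fin 2 → F, e ≠ 0 ∧
      FixesLine (q.1 : Matrix (Fin 2) (Fin 2) F) e ∧
      FixesLine (q.2.1 : Matrix (Fin 2) (Fin 2) F) e ∧
      FixesLine (q.2.2 : Matrix (Fin 2) (Fin 2) F) e
  let T₃ := (T \ T₁) \ T₂
  have c1 : T₁.card ≤ 3 * S.card ^ 2 := by
    have hS2 : (S ×ˢ S).card = S.card ^ 2 := by rw [Finset.card_product, pow_two]
    refine (Finset.card_union_le _ _).trans ?_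
    have := Finset.card_union_le ((S ×ˢ S).image fun q => (q.1, q.1, q.2))
      ((S ×ˢ S).image fun q => (q.1, q.2, q.1))
    have i1 := Finset.card_image_le (s := S ×ˢ S) (f := fun q => (q.1, q.1, q.2))
    have i2 := Finset.card_image_le (s := S ×ˢ S) (f := fun q => (q.1, q.2, q.1))
    have i3 := Finset.card_image_le (s := S ×ˢ S) (f := fun q => (q.1, q.2, q.2))
    omega
  have c2 : T₂.card ≤ S.card * 2 * (2 * M) ^ 2 := card_common_fixed_line_le hinv hS ht hSt hM
  have c3 : T₃.card ≤ 2 * (A ^ 2).card ^ 2 := by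
    let φ : SLTwo F × SLTwo F × SLTwo F → SLTwo F × SLTwo F := fun q => (q.1⁻¹ * q.2.1, q.1⁻¹ * q.2.2)
    have hφ : T₃.image φ ⊆ (A ^ 2) ×ˢ (A ^ 2) := by
      rw [Finset.image_subset_iff]
      rintro ⟨x, y, z⟩ hq
      simp only [T₃, T, Finset.mem_sdiff, Finset.mem_product] at hq
      obtain ⟨⟨⟨hx, hy, hz⟩, -⟩, -⟩ := hq
      have hxi : x⁻¹ ∈ A := by rw [← hinv]; exact Finset.inv_mem_inv (hS hx)
      rw [pow_two]
      exact Finset.mem_product.2 ⟨Finset.mul_mem_mul hxi (hS hy), Finset.mul_mem_mul hxi (hS hz)⟩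
    have hfib : ∀ b ∈ T₃.image φ, (T₃.filter fun q => φ q = b).card ≤ 2 := by
      intro b _
      by_contra! h
      obtain ⟨⟨x, y, z⟩, hx, ⟨x₁, y₁, z₁⟩, hx₁, ⟨x₂, y₂, z₂⟩, hx₂, h01, h02, h12⟩ :=
        Finset.two_lt_card.1 h
      simp only [T₃, T₂, T₁, T, Finset.mem_filter, Finset.mem_sdiff, Finset.mem_product,
        Finset.mem_union, Finset.mem_image, Prod.exists, not_or, not_and, not_exists] at hx hx₁ hx₂
      obtain ⟨⟨⟨⟨hxS, hyS, hzS⟩, hdist⟩, hline⟩, hb⟩ := hx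
      obtain ⟨⟨⟨⟨hxS₁, hyS₁, hzS₁⟩, -⟩, -⟩, hb₁⟩ := hx₁
      obtain ⟨⟨⟨⟨hxS₂, hyS₂, hzS₂⟩, -⟩, -⟩, hb₂⟩ := hx₂
      have e1 := Prod.ext_iff.1 (hb₁.trans hb.symm)
      have e2 := Prod.ext_iff.1 (hb₂.trans hb.symm)
      simp only [φ] at e1 e2
      have y1 : x₁ * (x⁻¹ * y) = y₁ := by rw [← e1.1, mul_inv_cancel_left]
      have z1 : x₁ * (x⁻¹ * z) = z₁ := by rw [← e1.2, mul_inv_cancel_left]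
      have y2 : x₂ * (x⁻¹ * y) = y₂ := by rw [← e2.1, mul_inv_cancel_left]
      have z2 : x₂ * (x⁻¹ * z) = z₂ := by rw [← e2.2, mul_inv_cancel_left]
      obtain ⟨e, he, f1, f2, f3⟩ := exists_common_fixed_line ht0 (hSt x hxS) (hSt y hyS) (hSt z hzS)
        (fun hxy => hdist.1.1 x z ⟨hxS, hzS⟩ (by rw [hxy]))
        (fun hxz => hdist.1.2 x y ⟨hxS, hyS⟩ (by rw [hxz]))
        (fun hyz => hdist.2 x y ⟨hxS, hyS⟩ (by rw [hyz])) (x₁ := x₁) (x₂ := x₂)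
        (by rintro rfl; apply h01; rw [← y1, ← z1]; simp)
        (by rintro rfl; apply h02; rw [← y2, ← z2]; simp)
        (by rintro rfl; apply h12; rw [← y1, ← z1, ← y2, ← z2])
        (hSt _ hxS₁) (hSt _ hxS₂) (by rw [y1]; exact hSt _ hyS₁) (by rw [y2]; exact hSt _ hyS₂)
        (by rw [z1]; exact hSt _ hzS₁) (by rw [z2]; exact hSt _ hzS₂)
      exact hline ⟨hxS, hyS, hzS⟩ e he f1 f2 f3
    calc T₃.card ≤ 2 * (T₃.image φ).card := Finset.card_le_mul_card_image _ _ hfib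
      _ ≤ 2 * ((A ^ 2) ×ˢ (A ^ 2)).card := by gcongr
      _ = _ := by rw [Finset.card_product, pow_two (A ^ 2).card]
  have hT : T ⊆ T₁ ∪ T₂ ∪ T₃ := by
    intro q hq
    simp only [T₃, Finset.mem_union, Finset.mem_sdiff]
    tauto
  calc S.card ^ 3 = T.card := by simp only [T, Finset.card_product]; ring
    _ ≤ (T₁ ∪ T₂ ∪ T₃).card := Finset.card_le_card hT
    _ ≤ (T₁ ∪ T₂).card + T₃.card := Finset.card_union_le _ _
    _ ≤ T₁.card + T₂.card + T₃.card := by gcongr; exact Finset.card_union_le _ _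
    _ ≤ _ := by omega

/-- Dimensional estimate: a set growing slowly has few elements of a given generic trace. -/
theorem card_slice_le {A : Finset (SLTwo F)} (h1 : 1 ∈ A) (hinv : A⁻¹ = A)
    (hgen : Subgroup.closure (A : Set (SLTwo F)) = ⊤) {t : F} (ht0 : t ≠ 0) (ht : t ^ 2 ≠ 4) :
    (A.filter fun g => tr g = t).card ^ 3 ≤ 1728 * (A ^ 8).card ^ 2 := by
  obtain ⟨Q, hQ⟩ : ∃ Q, Q = (A ^ 8).card := ⟨_, rfl⟩
  have hQ1 : 1 ≤ Q := by
    rw [hQ]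
    exact Finset.card_pos.2 ⟨1, Finset.one_mem_pow h1⟩
  have hex : ∃ M : ℕ, M ^ 3 ≤ 2 * Q ∧
      ∀ e : Fin 2 → F, e ≠ 0 → ((A ^ 2).filter fun g => act g e = e).card ≤ M := by
    -- An integer cube root of 2Q: from m²(m − 1) ≤ Q one gets m³ ≤ 2Q as soon as m ≥ 2.
    let M := Nat.findGreatest (fun m => m ^ 3 ≤ 2 * Q) (2 * Q)
    refine ⟨M, Nat.findGreatest_spec (P := fun m => m ^ 3 ≤ 2 * Q) (m := 0) (by omega) (by simp),
      fun e he => ?_⟩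
    have hst := card_stabilizer_le hinv hgen he
    rw [← hQ] at hst
    generalize ((A ^ 2).filter fun g => act g e = e).card = m at hst
    have hm : m ^ 3 ≤ 2 * Q := by
      rcases m with _ | _ | m
      · simp
      · omega
      · simp only [Nat.add_sub_cancel] at hst
        nlinarith
    refine Nat.le_findGreatest ?_ hm
    calc m ≤ m ^ 3 := Nat.le_self_pow (by norm_num) m
      _ ≤ _ := hm
  obtain ⟨M, hM3, hM⟩ := hex
  have hcube := card_slice_cube_le hinv (Finset.filter_subset (fun g => tr g = t) A) ht0 ht
    (fun g hg => (Finset.mem_filter.1 hg).2) hM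
  have hA2 : (A ^ 2).card ≤ Q := by
    rw [hQ]; exact Finset.card_le_card (Finset.pow_subset_pow_right h1 (by norm_num))
  rw [← hQ]
  generalize (A.filter fun g => tr g = t).card = N at hcube
  have hA22 : (A ^ 2).card ^ 2 ≤ Q ^ 2 := Nat.pow_le_pow_left hA2 2
  -- If N > 12 and N > 6M, the two degenerate terms are at most N³/4 and 2N³/9, so they are
  -- absorbed. The constant 1728 = 12³ comes from the case N ≤ 12.
  by_cases hN : N ≤ 12
  · calc N ^ 3 ≤ 12 ^ 3 := Nat.pow_le_pow_left hN 3
      _ ≤ 1728 * Q ^ 2 := by nlinarith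
  by_cases hNM : N ≤ 6 * M
  · calc N ^ 3 ≤ (6 * M) ^ 3 := Nat.pow_le_pow_left hNM 3
      _ = 216 * M ^ 3 := by ring
      _ ≤ 1728 * Q ^ 2 := by nlinarith
  push Not at hN hNM
  have k1 : 12 * N ^ 2 ≤ N ^ 3 := by
    have : 12 * N ^ 2 ≤ N * N ^ 2 := Nat.mul_le_mul_right _ hN.le
    linarith [pow_succ' N 2]
  have k2 : 36 * (N * M ^ 2) ≤ N ^ 3 := by
    have : (6 * M) ^ 2 ≤ N ^ 2 := Nat.pow_le_pow_left hNM.le 2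
    have : N * (6 * M) ^ 2 ≤ N * N ^ 2 := Nat.mul_le_mul_left _ this
    linarith [pow_succ' N 2]
  have := Nat.zero_le (Q ^ 2)
  linarith

end Slice


/-! ### Centralizers of regular semisimple elements -/

section Centralizer

variable {F : Type*} [Field F]

/-- The discriminant of the characteristic polynomial, and the Killing pairing of two elements. -/
def pairing (g k : SLTwo F) : F :=
  (g 0 0 - g 1 1) * (k 0 0 - k 1 1) + 2 * g 0 1 * k 1 0 + 2 * g 1 0 * k 0 1

lemma pairing_self (k : SLTwo F) : pairing k k = tr k ^ 2 - 4 := by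
  simp only [pairing, tr]; linear_combination -4 * det_eq k

lemma cross_of_commute {g k : SLTwo F} (h : g * k = k * g) :
    g 0 1 * k 1 0 = g 1 0 * k 0 1 ∧ (g 0 0 - g 1 1) * k 0 1 = g 0 1 * (k 0 0 - k 1 1) ∧
      (g 0 0 - g 1 1) * k 1 0 = g 1 0 * (k 0 0 - k 1 1) := by
  have h00 : (g * k) 0 0 = (k * g) 0 0 := by rw [h]
  have h01 : (g * k) 0 1 = (k * g) 0 1 := by rw [h]
  have h10 : (g * k) 1 0 = (k * g) 1 0 := by rw [h]
  rw [mul_entry, mul_entry] at h00 h01 h10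
  exact ⟨by linear_combination h00, by linear_combination h01, by linear_combination -h10⟩

/-- The traceless part of an element commuting with `k` is proportional to that of `k`. -/
lemma proportional_of_commute {g k : SLTwo F} (h : g * k = k * g) :
    pairing k k * (g 0 0 - g 1 1) = pairing g k * (k 0 0 - k 1 1) ∧
      pairing k k * g 0 1 = pairing g k * k 0 1 ∧ pairing k k * g 1 0 = pairing g k * k 1 0 := by
  obtain ⟨h1, h2, h3⟩ := cross_of_commute h
  simp only [pairing]
  exact ⟨by linear_combination 2 * k 1 0 * h2 + 2 * k 0 1 * h3,
    by linear_combination 2 * k 0 1 * h1 - (k 0 0 - k 1 1) * h2,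
    by linear_combination -2 * k 1 0 * h1 - (k 0 0 - k 1 1) * h3⟩

/-- The centralizer of k is a torus: since `pairing k k` = tr² − 4 is nonzero, the traceless parts
of g and h both lie on the line of that of k. -/
lemma commute_trans {g h k : SLTwo F} (hk : tr k ^ 2 ≠ 4) (hg : g * k = k * g)
    (hh : h * k = k * h) : g * h = h * g := by
  have hD : pairing k k ≠ 0 := by rw [pairing_self]; exact sub_ne_zero.2 hk
  obtain ⟨g1, g2, g3⟩ := proportional_of_commute hg
  obtain ⟨h1, h2, h3⟩ := proportional_of_commute hh
  have c1 : g 0 1 * h 1 0 = g 1 0 * h 0 1 := by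
    apply mul_left_cancel₀ hD
    apply mul_left_cancel₀ hD
    linear_combination pairing k k * h 1 0 * g2 + pairing g k * k 0 1 * h3
      - pairing k k * h 0 1 * g3 - pairing g k * k 1 0 * h2
  have c2 : (g 0 0 - g 1 1) * h 0 1 = g 0 1 * (h 0 0 - h 1 1) := by
    apply mul_left_cancel₀ hD
    apply mul_left_cancel₀ hD
    linear_combination pairing k k * h 0 1 * g1 + pairing g k * (k 0 0 - k 1 1) * h2
      - pairing k k * (h 0 0 - h 1 1) * g2 - pairing g k * k 0 1 * h1
  have c3 : (g 0 0 - g 1 1) * h 1 0 = g 1 0 * (h 0 0 - h 1 1) := by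
    apply mul_left_cancel₀ hD
    apply mul_left_cancel₀ hD
    linear_combination pairing k k * h 1 0 * g1 + pairing g k * (k 0 0 - k 1 1) * h3
      - pairing k k * (h 0 0 - h 1 1) * g3 - pairing g k * k 1 0 * h1
  apply ext_entries <;> rw [mul_entry, mul_entry]
  · linear_combination c1
  · linear_combination c2
  · linear_combination -c3
  · linear_combination -c1

variable [Fintype F] [DecidableEq F]

/-- The traceless part of g is λ times that of k, and comparing discriminants gives λ²(tr(k)² − 4) =
s² − 4. As 2 is invertible, λ and s determine g. -/
lemma card_commuting_trace_le (h2 : (2 : F) ≠ 0) {k : SLTwo F} (hk : tr k ^ 2 ≠ 4) (s : F) :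
    (Finset.univ.filter fun g : SLTwo F => g * k = k * g ∧ tr g = s).card ≤ 2 := by
  have hD : pairing k k ≠ 0 := by rw [pairing_self]; exact sub_ne_zero.2 hk
  refine le_trans ?_ (card_quadratic_roots_le (pairing k k) 0 (-(s ^ 2 - 4)) hD)
  apply Finset.card_le_card_of_injOn (fun g => pairing g k / pairing k k)
  · intro g hg
    simp only [Finset.coe_filter, Finset.mem_univ, true_and, Set.mem_ofPred_eq] at hg ⊢
    obtain ⟨g1, g2, g3⟩ := proportional_of_commute hg.1
    have : pairing k k * (tr g ^ 2 - 4) = pairing g k ^ 2 := by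
      apply mul_left_cancel₀ hD
      rw [← pairing_self]
      have e1 : pairing k k * pairing g g = (pairing k k * (g 0 0 - g 1 1)) * (g 0 0 - g 1 1)
        + 2 * (pairing k k * g 0 1) * g 1 0 + 2 * (pairing k k * g 1 0) * g 0 1 := by
        simp only [pairing]; ring
      have e2 : pairing k k * pairing g k = (pairing k k * (g 0 0 - g 1 1)) * (k 0 0 - k 1 1)
        + 2 * (pairing k k * g 0 1) * k 1 0 + 2 * (pairing k k * g 1 0) * k 0 1 := by
        simp only [pairing]; ring
      rw [e1, g1, g2, g3]
      have e3 : pairing k k * pairing g k ^ 2 = pairing g k * (pairing k k * pairing g k) := by ring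
      rw [e3, e2]
      ring
    rw [← hg.2]
    field_simp
    linear_combination -this
  · intro g hg g' hg' heq
    simp only [Finset.coe_filter, Finset.mem_univ, true_and, Set.mem_ofPred_eq] at hg hg'
    have hB : pairing g k = pairing g' k := by
      simpa [div_left_inj' hD] using heq
    obtain ⟨g1, g2, g3⟩ := proportional_of_commute hg.1
    obtain ⟨g1', g2', g3'⟩ := proportional_of_commute hg'.1
    rw [hB] at g1 g2 g3
    have k1 := mul_left_cancel₀ hD (g1.trans g1'.symm)
    have ht := hg.2.trans hg'.2.symm
    simp only [tr] at ht
    apply ext_entries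
    · apply mul_left_cancel₀ h2; linear_combination k1 + ht
    · exact mul_left_cancel₀ hD (g2.trans g2'.symm)
    · exact mul_left_cancel₀ hD (g3.trans g3'.symm)
    · apply mul_left_cancel₀ h2; linear_combination ht - k1

lemma card_commuting_le (h2 : (2 : F) ≠ 0) {k : SLTwo F} (hk : tr k ^ 2 ≠ 4) :
    (Finset.univ.filter fun g : SLTwo F => g * k = k * g).card ≤ 2 * Fintype.card F := by
  have hsub : (Finset.univ.filter fun g : SLTwo F => g * k = k * g) ⊆
      Finset.univ.biUnion fun s => Finset.univ.filter fun g : SLTwo F =>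
        g * k = k * g ∧ tr g = s := by
    intro g hg
    simpa using hg
  calc _ ≤ _ := Finset.card_le_card hsub
    _ ≤ Finset.univ.card * 2 :=
      Finset.card_biUnion_le_card_mul _ _ _ fun s _ => card_commuting_trace_le h2 hk s
    _ = _ := by rw [Finset.card_univ, mul_comm]

lemma card_commuting_exceptional_le (h2 : (2 : F) ≠ 0) {k : SLTwo F} (hk : tr k ^ 2 ≠ 4) :
    (Finset.univ.filter fun g : SLTwo F => g * k = k * g ∧ ¬(tr g ≠ 0 ∧ tr g ^ 2 ≠ 4)).card ≤ 6 := by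
  have hsub : (Finset.univ.filter fun g : SLTwo F =>
        g * k = k * g ∧ ¬(tr g ≠ 0 ∧ tr g ^ 2 ≠ 4)) ⊆
      ({0, 2, -2} : Finset F).biUnion fun s => Finset.univ.filter fun g : SLTwo F =>
        g * k = k * g ∧ tr g = s := by
    intro g hg
    simp only [Finset.mem_filter, Finset.mem_univ, true_and, Finset.mem_biUnion] at hg ⊢
    refine ⟨tr g, ?_, hg.1, rfl⟩
    by_cases h0 : tr g = 0
    · simp [h0]
    · have h4 : tr g ^ 2 = 4 := by tauto
      have : (tr g - 2) * (tr g + 2) = 0 := by linear_combination h4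
      rcases mul_eq_zero.1 this with h | h
      · simp [sub_eq_zero.1 h]
      · simp [eq_neg_of_add_eq_zero_left h]
  calc _ ≤ _ := Finset.card_le_card hsub
    _ ≤ ({0, 2, -2} : Finset F).card * 2 :=
      Finset.card_biUnion_le_card_mul _ _ _ fun s _ => card_commuting_trace_le h2 hk s
    _ ≤ 3 * 2 := Nat.mul_le_mul_right _ Finset.card_le_three

/-- Only matrices with nonzero upper left entry are counted; there the other entries of the first
row and column are free. -/
lemma card_group_ge :
    (Fintype.card F - 1) * Fintype.card F ^ 2 ≤ Fintype.card (SLTwo F) := by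
  let f : {a : F // a ≠ 0} × F × F → SLTwo F := fun q =>
    ⟨!![q.1.1, q.2.1; q.2.2, (1 + q.2.1 * q.2.2) / q.1.1], by
      have := q.1.2
      rw [Matrix.det_fin_two_of]; field_simp; ring⟩
  have hf : Function.Injective f := by
    rintro ⟨⟨a, ha⟩, b, c⟩ ⟨⟨a', ha'⟩, b', c'⟩ h
    have h00 : f (⟨a, ha⟩, b, c) 0 0 = f (⟨a', ha'⟩, b', c') 0 0 := by rw [h]
    have h01 : f (⟨a, ha⟩, b, c) 0 1 = f (⟨a', ha'⟩, b', c') 0 1 := by rw [h]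
    have h10 : f (⟨a, ha⟩, b, c) 1 0 = f (⟨a', ha'⟩, b', c') 1 0 := by rw [h]
    simp [f] at h00 h01 h10
    simp [h00, h01, h10]
  have := Fintype.card_le_of_injective f hf
  have hc : Fintype.card {a : F // a ≠ 0} = Fintype.card F - 1 := by
    rw [Fintype.card_subtype_compl, Fintype.card_subtype_eq]
  rw [Fintype.card_prod, Fintype.card_prod, hc] at this
  rwa [pow_two]

end Centralizer

/-! ### Escape from the traces 0 and ±2 -/

section Escape

variable {F : Type*} [Field F]

/-- By Cayley–Hamilton x⁻¹ = tr(x) − x, so invariance under A extends to the group it generates.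
Hence W contains SL₂, which spans all matrices. -/
lemma span_eq_top_of_invariant {W : Submodule F (Matrix (Fin 2) (Fin 2) F)} (h1 : 1 ∈ W)
    {A : Set (SLTwo F)} (hgen : Subgroup.closure A = ⊤)
    (hA : ∀ g ∈ A, ∀ w ∈ W, (g : Matrix (Fin 2) (Fin 2) F) * w ∈ W) : W = ⊤ := by
  have key : ∀ g : SLTwo F, ∀ w ∈ W, (g : Matrix (Fin 2) (Fin 2) F) * w ∈ W := by
    intro g
    have hg : g ∈ Subgroup.closure A := by rw [hgen]; trivial
    induction hg using Subgroup.closure_induction with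
    | mem x hx => exact hA x hx
    | one => simp
    | mul x y _ _ hx hy =>
      intro w hw
      rw [Matrix.SpecialLinearGroup.coe_mul, mul_assoc]
      exact hx _ (hy _ hw)
    | inv x _ hx =>
      intro w hw
      have : ((x⁻¹ : SLTwo F) : Matrix (Fin 2) (Fin 2) F) =
          tr x • (1 : Matrix (Fin 2) (Fin 2) F) - (x : Matrix (Fin 2) (Fin 2) F) := by
        obtain ⟨e00, e01, e10, e11⟩ := inv_entries x
        ext i j
        fin_cases i <;> fin_cases j <;> simp [tr, -Matrix.SpecialLinearGroup.coe_inv, *]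
      rw [this, sub_mul, smul_mul_assoc, one_mul]
      exact W.sub_mem (W.smul_mem _ hw) (hx w hw)
  have mem : ∀ g : SLTwo F, (g : Matrix (Fin 2) (Fin 2) F) ∈ W := fun g => by
    simpa using key g 1 h1
  have m1 : !![1, 1; 0, 1] ∈ W := mem ⟨!![1, 1; 0, 1], by simp [Matrix.det_fin_two_of]⟩
  have m2 : !![1, 0; 1, 1] ∈ W := mem ⟨!![1, 0; 1, 1], by simp [Matrix.det_fin_two_of]⟩
  have m3 : !![0, 1; -1, 1] ∈ W := mem ⟨!![0, 1; -1, 1], by simp [Matrix.det_fin_two_of]⟩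
  rw [eq_top_iff]
  rintro m -
  have hm : m = (m 0 0) • (1 : Matrix (Fin 2) (Fin 2) F) + (m 0 1) • (!![1, 1; 0, 1] - 1)
      + (m 1 0) • (!![1, 0; 1, 1] - 1)
      + (m 1 1 - m 0 0) • (!![0, 1; -1, 1] - (!![1, 1; 0, 1] - 1) + (!![1, 0; 1, 1] - 1)) := by
    ext i j
    fin_cases i <;> fin_cases j <;> simp
  rw [hm]
  exact W.add_mem (W.add_mem (W.add_mem (W.smul_mem _ h1) (W.smul_mem _ (W.sub_mem m1 h1)))
    (W.smul_mem _ (W.sub_mem m2 h1)))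
    (W.smul_mem _ (W.add_mem (W.sub_mem m3 (W.sub_mem m1 h1)) (W.sub_mem m2 h1)))

variable [DecidableEq F]

/-- The linear span of the `k`-fold products of `A`. -/
def powSpan (A : Finset (SLTwo F)) (k : ℕ) : Submodule F (Matrix (Fin 2) (Fin 2) F) :=
  Submodule.span F ((fun g : SLTwo F => (g : Matrix (Fin 2) (Fin 2) F)) '' (A ^ k : Finset (SLTwo F)))

/-- If the span did not grow in one step, it would be invariant under left multiplication by A. -/
lemma powSpan_lt_succ {A : Finset (SLTwo F)} (h1 : 1 ∈ A)
    (hgen : Subgroup.closure (A : Set (SLTwo F)) = ⊤) (k : ℕ) (hk : powSpan A k ≠ ⊤) :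
    powSpan A k < powSpan A (k + 1) := by
  refine lt_of_le_of_ne (Submodule.span_mono (Set.image_mono ?_)) fun heq => hk ?_
  · exact_mod_cast Finset.pow_subset_pow_right h1 (Nat.le_succ k)
  · refine span_eq_top_of_invariant (Submodule.subset_span ⟨1, ?_, by simp⟩) hgen fun g hg w hw => ?_
    · exact Finset.one_mem_pow h1
    · have hle : powSpan A k ≤ (powSpan A k).comap
          (LinearMap.mulLeft F (g : Matrix (Fin 2) (Fin 2) F)) := by
        conv_lhs => rw [powSpan]
        rw [Submodule.span_le]
        rintro _ ⟨x, hx, rfl⟩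
        change (g : Matrix (Fin 2) (Fin 2) F) * (x : Matrix (Fin 2) (Fin 2) F) ∈ powSpan A k
        rw [heq]
        refine Submodule.subset_span ⟨g * x, ?_, by simp⟩
        rw [pow_succ']
        exact Finset.mul_mem_mul hg hx
      exact hle hw

/-- The dimension starts at 1 or more and rises strictly until it reaches 4. -/
lemma powSpan_three {A : Finset (SLTwo F)} (h1 : 1 ∈ A)
    (hgen : Subgroup.closure (A : Set (SLTwo F)) = ⊤) : powSpan A 3 = ⊤ := by
  by_contra h3
  have mono : ∀ k, powSpan A k ≤ powSpan A (k + 1) := fun k =>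
    Submodule.span_mono (Set.image_mono
      (by exact_mod_cast Finset.pow_subset_pow_right h1 (Nat.le_succ k)))
  have h2 : powSpan A 2 ≠ ⊤ := fun h => h3 (top_le_iff.1 (h ▸ mono 2))
  have h1' : powSpan A 1 ≠ ⊤ := fun h => h2 (top_le_iff.1 (h ▸ mono 1))
  have h0 : powSpan A 0 ≠ ⊤ := fun h => h1' (top_le_iff.1 (h ▸ mono 0))
  have hb : (⊥ : Submodule F (Matrix (Fin 2) (Fin 2) F)) < powSpan A 0 := by
    rw [bot_lt_iff_ne_bot]
    intro h
    have : (1 : Matrix (Fin 2) (Fin 2) F) ∈ powSpan A 0 :=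
      Submodule.subset_span ⟨1, by simp, by simp⟩
    rw [h] at this
    simp at this
  have f0 := Submodule.finrank_lt_finrank_of_lt hb
  have f1 : _ < Module.finrank F (powSpan A 1) :=
    Submodule.finrank_lt_finrank_of_lt (powSpan_lt_succ h1 hgen 0 h0)
  have f2 : _ < Module.finrank F (powSpan A 2) :=
    Submodule.finrank_lt_finrank_of_lt (powSpan_lt_succ h1 hgen 1 h1')
  have f3 : _ < Module.finrank F (powSpan A 3) :=
    Submodule.finrank_lt_finrank_of_lt (powSpan_lt_succ h1 hgen 2 h2)
  have f4 := Submodule.finrank_lt h3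
  rw [Module.finrank_matrix, Module.finrank_self, Fintype.card_fin] at f4
  rw [finrank_bot] at f0
  omega

/-- Escape from the elements of trace `0, ±2`. -/
lemma exists_generic_trace {A : Finset (SLTwo F)} (h1 : 1 ∈ A)
    (hgen : Subgroup.closure (A : Set (SLTwo F)) = ⊤) (hA : 81 < A.card) :
    ∃ h ∈ A ^ 4, tr h ≠ 0 ∧ tr h ^ 2 ≠ 4 := by
  by_contra! hall
  obtain ⟨b, hbs, hspan, hli⟩ := exists_linearIndependent F
    ((fun g : SLTwo F => (g : Matrix (Fin 2) (Fin 2) F)) '' (A ^ 3 : Finset (SLTwo F)))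
  have htop : Submodule.span F b = ⊤ := hspan.trans (powSpan_three h1 hgen)
  have : Fintype b := hli.setFinite.fintype
  have hcard : Fintype.card b ≤ 4 := by
    have := hli.fintype_card_le_finrank
    rwa [Module.finrank_matrix, Module.finrank_self, Fintype.card_fin] at this
  have hvals : ∀ s : F, (s ≠ 0 → s ^ 2 = 4) → s ∈ ({0, 2, -2} : Finset F) := by
    intro s hs
    by_cases h0 : s = 0
    · simp [h0]
    · have : (s - 2) * (s + 2) = 0 := by linear_combination hs h0
      rcases mul_eq_zero.1 this with h | h
      · simp [sub_eq_zero.1 h]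
      · simp [eq_neg_of_add_eq_zero_left h]
  -- The trace form is nondegenerate, so x is determined by tr(xg) for g in a basis taken from A³.
  -- All these traces would lie in {0, 2, −2}, giving |A| ≤ 3⁴ = 81.
  have hle : A.card ≤ (Fintype.piFinset fun _ : b => ({0, 2, -2} : Finset F)).card := by
    apply Finset.card_le_card_of_injOn
      (fun (x : SLTwo F) (i : b) => Matrix.trace ((x : Matrix (Fin 2) (Fin 2) F) * i.1))
    · intro x hx
      rw [Finset.mem_coe, Fintype.mem_piFinset]
      rintro ⟨m, hm⟩
      obtain ⟨g, hg, rfl⟩ := hbs hm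
      have hxg : x * g ∈ A ^ 4 := by
        rw [pow_succ' A 3]; exact Finset.mul_mem_mul hx hg
      have := hvals (tr (x * g)) (hall _ hxg)
      rwa [tr, ← Matrix.trace_fin_two, Matrix.SpecialLinearGroup.coe_mul] at this
    · intro x _ y _ hxy
      have hle : (⊤ : Submodule F (Matrix (Fin 2) (Fin 2) F)) ≤ LinearMap.ker
          ((Matrix.traceLinearMap (Fin 2) F F).comp
            (LinearMap.mulLeft F ((x : Matrix (Fin 2) (Fin 2) F) - (y : Matrix (Fin 2) (Fin 2) F)))) := by
        rw [← htop, Submodule.span_le]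
        intro m hm
        have := congrFun hxy ⟨m, hm⟩
        simp only at this
        simp [sub_mul, this]
      have hz : ∀ m : Matrix (Fin 2) (Fin 2) F, Matrix.trace (((x : Matrix (Fin 2) (Fin 2) F) - (y : Matrix (Fin 2) (Fin 2) F)) * m) = 0 :=
        fun m => hle (x := m) trivial
      have : (x : Matrix (Fin 2) (Fin 2) F) - (y : Matrix (Fin 2) (Fin 2) F) = 0 := by
        ext i j
        have := hz (Matrix.single j i 1)
        rw [Matrix.trace_mul_single] at this
        simpa using this
      exact Subtype.ext (sub_eq_zero.1 this)
  rw [Fintype.card_piFinset, Finset.prod_const, Finset.card_univ] at hle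
  have : ({0, 2, -2} : Finset F).card ^ Fintype.card b ≤ 3 ^ 4 :=
    (Nat.pow_le_pow_left Finset.card_le_three _).trans (Nat.pow_le_pow_right (by norm_num) hcard)
  omega

end Escape


/-! ### Pivoting over the conjugates of a torus -/

section Pivot

variable {F : Type*} [Field F] [Fintype F] [DecidableEq F]

omit [Fintype F] in
/-- Orbit-stabilizer for the conjugation action restricted to a finite set. -/
lemma card_le_centralizer_mul_class {A : Finset (SLTwo F)} (hinv : A⁻¹ = A) {h : SLTwo F}
    (hh : h ∈ A ^ 4) : A.card ≤ ((A ^ 2).filter fun g => g * h = h * g).card *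
      ((A ^ 6).filter fun g => tr g = tr h).card := by
  have hmaps : ∀ a ∈ A, a * h * a⁻¹ ∈ (A ^ 6).filter fun g => tr g = tr h := by
    intro a ha
    rw [Finset.mem_filter]
    refine ⟨?_, tr_conj a h⟩
    have : A ^ 6 = A * A ^ 4 * A := by simp only [← pow_succ, ← pow_succ']
    rw [this]
    refine Finset.mul_mem_mul (Finset.mul_mem_mul ha hh) ?_
    rw [← hinv]
    exact Finset.inv_mem_inv ha
  refine Finset.card_le_mul_card_image_of_maps_to hmaps _ fun b _ => ?_
  rcases (A.filter fun a => a * h * a⁻¹ = b).eq_empty_or_nonempty with h0 | ⟨a₀, ha₀⟩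
  · simp [h0]
  rw [Finset.mem_filter] at ha₀
  apply Finset.card_le_card_of_injOn (fun a => a₀⁻¹ * a)
  · intro a ha
    simp only [Finset.coe_filter, Set.mem_ofPred_eq] at ha ⊢
    refine ⟨?_, ?_⟩
    · rw [pow_two]
      refine Finset.mul_mem_mul ?_ ha.1
      rw [← hinv]
      exact Finset.inv_mem_inv ha₀.1
    · have e := ha.2.trans ha₀.2.symm
      have e1 : a * h = a₀ * h * a₀⁻¹ * a := by rw [← e]; group
      rw [mul_assoc, e1]; group
  · intro a _ b _ e
    exact mul_left_cancel e

/-- A torus meeting `A ^ 4` in a generic element contains many generic elements of `A ^ 2`. -/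
lemma many_generic_commuting {A : Finset (SLTwo F)} (h2 : (2 : F) ≠ 0) (h1 : 1 ∈ A)
    (hinv : A⁻¹ = A) (hgen : Subgroup.closure (A : Set (SLTwo F)) = ⊤) {L : ℕ}
    (hL : 1728 * (A ^ 48).card ^ 2 * (L + 5) ^ 3 < A.card ^ 3)
    {h : SLTwo F} (hh : h ∈ A ^ 4) (hh0 : tr h ≠ 0) (hh4 : tr h ^ 2 ≠ 4) :
    L ≤ ((A ^ 2).filter fun g => g * h = h * g ∧ (tr g ≠ 0 ∧ tr g ^ 2 ≠ 4)).card := by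
  have horb := card_le_centralizer_mul_class hinv hh
  have hgen6 : Subgroup.closure ((A ^ 6 : Finset (SLTwo F)) : Set (SLTwo F)) = ⊤ := by
    rw [eq_top_iff, ← hgen]
    apply Subgroup.closure_mono
    exact_mod_cast Finset.subset_pow h1 (by norm_num)
  -- Applied to A⁶, which contains the conjugates of h by A; this is where the power 48 = 6 · 8
  -- arises.
  have hslice := card_slice_le (Finset.one_mem_pow (n := 6) h1) (by rw [← inv_pow, hinv]) hgen6 hh0 hh4
  rw [← pow_mul] at hslice
  norm_num only at hslice
  have hsplit : ((A ^ 2).filter fun g => g * h = h * g).card ≤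
      ((A ^ 2).filter fun g => g * h = h * g ∧ (tr g ≠ 0 ∧ tr g ^ 2 ≠ 4)).card + 6 := by
    rw [← Finset.card_filter_add_card_filter_not (s := (A ^ 2).filter fun g => g * h = h * g)
      (fun g => tr g ≠ 0 ∧ tr g ^ 2 ≠ 4)]
    rw [Finset.filter_filter, Finset.filter_filter]
    gcongr
    refine le_trans (Finset.card_le_card ?_) (card_commuting_exceptional_le h2 hh4)
    intro g hg
    simp only [Finset.mem_filter, Finset.mem_univ, true_and] at hg ⊢
    exact hg.2
  generalize ((A ^ 2).filter fun g => g * h = h * g ∧ (tr g ≠ 0 ∧ tr g ^ 2 ≠ 4)).card = c at *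
  generalize ((A ^ 2).filter fun g => g * h = h * g).card = d at *
  generalize ((A ^ 6).filter fun g => tr g = tr h).card = s at *
  by_contra! hc
  -- At most L − 1 generic elements and at most six exceptional ones.
  have hd : d ≤ L + 5 := by omega
  have : A.card ^ 3 ≤ 1728 * (A ^ 48).card ^ 2 * (L + 5) ^ 3 := by
    calc A.card ^ 3 ≤ (d * s) ^ 3 := Nat.pow_le_pow_left horb 3
      _ = s ^ 3 * d ^ 3 := by ring
      _ ≤ _ := Nat.mul_le_mul hslice (Nat.pow_le_pow_left hd 3)
  omega

/-- Pivoting: all conjugates of a generic torus meet `A ^ 2` in many generic elements, so that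
`A ^ 2` is large. -/
theorem card_group_mul_le {A : Finset (SLTwo F)} (h2 : (2 : F) ≠ 0) (h1 : 1 ∈ A)
    (hinv : A⁻¹ = A) (hgen : Subgroup.closure (A : Set (SLTwo F)) = ⊤) (hA : 81 < A.card) {L : ℕ}
    (hL1 : 1 ≤ L) (hL : 1728 * (A ^ 48).card ^ 2 * (L + 5) ^ 3 < A.card ^ 3) :
    Fintype.card (SLTwo F) * L ≤ 4 * Fintype.card F * (A ^ 2).card := by
  obtain ⟨h₀, hh₀, hz, h4⟩ := exists_generic_trace h1 hgen hA
  -- Every conjugate torus meets A⁴ generically. If k in A⁴ is a witness for y, its torus has a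
  -- generic x in A², and a x a⁻¹ in A⁴ is a witness for a y; since A is symmetric and generates,
  -- all of the group is reached.
  have hinvolved : ∀ g : SLTwo F, ∃ k ∈ A ^ 4, (tr k ≠ 0 ∧ tr k ^ 2 ≠ 4) ∧
      (g * h₀ * g⁻¹) * k = k * (g * h₀ * g⁻¹) := by
    intro g
    have hg : g ∈ Submonoid.closure (A : Set (SLTwo F)) := by
      have : g ∈ (Subgroup.closure (A : Set (SLTwo F))).toSubmonoid := by rw [hgen]; trivial
      rw [Subgroup.closure_toSubmonoid] at this
      have hAi : (A : Set (SLTwo F))⁻¹ = A := by rw [← Finset.coe_inv, hinv]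
      rwa [hAi, Set.union_self] at this
    induction hg using Submonoid.closure_induction_left with
    | one => exact ⟨h₀, hh₀, ⟨hz, h4⟩, by simp⟩
    | mul_left a ha y _ ih =>
      obtain ⟨k, hk, ⟨hk0, hk4⟩, hcomm⟩ := ih
      have hm := hL1.trans (many_generic_commuting h2 h1 hinv hgen hL hk hk0 hk4)
      obtain ⟨x, hx⟩ := Finset.card_pos.1 hm
      rw [Finset.mem_filter] at hx
      obtain ⟨hxA, hxk, hxg⟩ := hx
      refine ⟨a * x * a⁻¹, ?_, by rwa [tr_conj], ?_⟩
      · have : A ^ 4 = A * A ^ 2 * A := by simp only [← pow_succ, ← pow_succ']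
        rw [this]
        refine Finset.mul_mem_mul (Finset.mul_mem_mul ha hxA) ?_
        rw [← hinv]
        exact Finset.inv_mem_inv ha
      · have hc := commute_trans hk4 hcomm hxk
        calc a * y * h₀ * (a * y)⁻¹ * (a * x * a⁻¹) = a * ((y * h₀ * y⁻¹) * x) * a⁻¹ := by group
          _ = _ := by rw [hc]; group
  let O := Finset.univ.image fun g : SLTwo F => g * h₀ * g⁻¹
  have hO : Fintype.card (SLTwo F) ≤ 2 * Fintype.card F * O.card := by
    rw [← Finset.card_univ]
    refine Finset.card_le_mul_card_image _ _ fun b hb => ?_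
    obtain ⟨g₀, -, rfl⟩ := Finset.mem_image.1 hb
    refine le_trans ?_ (card_commuting_le h2 h4)
    apply Finset.card_le_card_of_injOn (fun a => g₀⁻¹ * a)
    · intro a ha
      simp only [Finset.coe_filter, Finset.mem_univ, true_and, Set.mem_ofPred_eq] at ha ⊢
      have e1 : a * h₀ = g₀ * h₀ * g₀⁻¹ * a := by rw [← ha]; group
      rw [mul_assoc, e1]; group
    · intro a _ b _ e
      exact mul_left_cancel e
  -- Double counting of commuting pairs: each conjugate h commutes with at least L generic x in A²,
  -- and each such x with at most two elements of trace tr h₀.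
  have hdouble : O.card * L ≤ ((A ^ 2).filter fun x => tr x ≠ 0 ∧ tr x ^ 2 ≠ 4).card * 2 := by
    apply Finset.card_mul_le_card_mul (fun h x => h * x = x * h)
    · intro h hh
      obtain ⟨g, -, rfl⟩ := Finset.mem_image.1 hh
      obtain ⟨k, hk, ⟨hk0, hk4⟩, hcomm⟩ := hinvolved g
      refine (many_generic_commuting h2 h1 hinv hgen hL hk hk0 hk4).trans (Finset.card_le_card ?_)
      intro x hx
      simp only [Finset.mem_filter, Finset.mem_bipartiteAbove] at hx ⊢
      exact ⟨⟨hx.1, hx.2.2⟩, commute_trans hk4 hcomm hx.2.1⟩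
    · intro x hx
      rw [Finset.mem_filter] at hx
      refine le_trans (Finset.card_le_card ?_) (card_commuting_trace_le h2 hx.2.2 (tr h₀))
      intro h hh
      simp only [Finset.mem_bipartiteBelow, Finset.mem_filter, Finset.mem_univ, true_and] at hh ⊢
      obtain ⟨g, -, rfl⟩ := Finset.mem_image.1 hh.1
      exact ⟨hh.2, tr_conj _ _⟩
  have hf := Finset.card_filter_le (A ^ 2) fun x => tr x ≠ 0 ∧ tr x ^ 2 ≠ 4
  calc _ ≤ 2 * Fintype.card F * O.card * L := Nat.mul_le_mul_right _ hO
    _ = 2 * Fintype.card F * (O.card * L) := by ring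
    _ ≤ 2 * Fintype.card F * ((A ^ 2).card * 2) :=
      Nat.mul_le_mul_left _ (hdouble.trans (Nat.mul_le_mul_right _ hf))
    _ = _ := by ring

end Pivot


/-! ### Very large sets: dilated sumsets and unipotent elements -/

lemma card_sq_le_card_image_mul_collisions {α β : Type*} [DecidableEq α] [DecidableEq β]
    (S : Finset α) (f : α → β) :
    S.card ^ 2 ≤ (S.image f).card * ((S ×ˢ S).filter fun q => f q.1 = f q.2).card := by
  have h1 : S.card = ∑ b ∈ S.image f, (S.filter fun a => f a = b).card :=
    Finset.card_eq_sum_card_image f S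
  have h2 : ((S ×ˢ S).filter fun q => f q.1 = f q.2).card =
      ∑ b ∈ S.image f, (S.filter fun a => f a = b).card ^ 2 := by
    rw [Finset.card_eq_sum_card_fiberwise (f := fun q => f q.1) (t := S.image f)]
    · refine Finset.sum_congr rfl fun b _ => ?_
      rw [pow_two, ← Finset.card_product]
      congr 1
      ext ⟨u, v⟩
      simp only [Finset.mem_filter, Finset.mem_product]
      constructor
      · rintro ⟨⟨⟨hu, hv⟩, huv⟩, hb⟩; exact ⟨⟨hu, hb⟩, hv, huv ▸ hb⟩
      · rintro ⟨⟨hu, hb⟩, hv, hb'⟩; exact ⟨⟨⟨hu, hv⟩, hb.trans hb'.symm⟩, hb⟩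
    · intro q hq
      simp only [Finset.coe_filter, Finset.mem_product, Set.mem_ofPred_eq] at hq
      exact Finset.mem_coe.2 (Finset.mem_image_of_mem _ hq.1.1)
  rw [h2]
  conv_lhs => rw [h1]
  exact sq_sum_le_card_mul_sum_sq

section Large

variable {F : Type*} [Field F] [Fintype F] [DecidableEq F]

/-- Dilates of a large set: for some `y ∈ Y` the sumset `X + y X` has more than half of the
elements of the field. -/
lemma exists_large_dilate_sum (X Y : Finset F)
    (h : Fintype.card F ^ 2 < Y.card * X.card ^ 2) :
    ∃ y ∈ Y, Fintype.card F < 2 * ((X ×ˢ X).image fun q => q.1 + y * q.2).card := by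
  by_contra! hsmall
  obtain ⟨q, hq⟩ : ∃ q, q = Fintype.card F := ⟨_, rfl⟩
  rw [← hq] at h hsmall
  -- The additive energy of X and yX. By Cauchy–Schwarz it is at least |X|⁴/q for every y, and twice
  -- that when the sumset has at most q/2 elements; summing over all y contradicts the upper bound
  -- below.
  let E (y : F) : Finset ((F × F) × (F × F)) := ((X ×ˢ X) ×ˢ (X ×ˢ X)).filter fun r =>
    r.1.1 + y * r.1.2 = r.2.1 + y * r.2.2
  have hXX : (X ×ˢ X).card = X.card ^ 2 := by rw [Finset.card_product, pow_two]
  have hCS : ∀ y, X.card ^ 4 ≤ ((X ×ˢ X).image fun q => q.1 + y * q.2).card * (E y).card := by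
    intro y
    have := card_sq_le_card_image_mul_collisions (X ×ˢ X) fun q => q.1 + y * q.2
    rwa [hXX, ← pow_mul] at this
  have hE1 : ∀ y, X.card ^ 4 ≤ q * (E y).card := fun y => by
    refine (hCS y).trans (Nat.mul_le_mul_right _ ?_)
    rw [hq]
    exact Finset.card_le_univ _
  have hE2 : ∀ y ∈ Y, 2 * X.card ^ 4 ≤ q * (E y).card := fun y hy => by
    calc 2 * X.card ^ 4 ≤ 2 * (((X ×ˢ X).image fun q => q.1 + y * q.2).card * (E y).card) :=
          Nat.mul_le_mul_left _ (hCS y)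
      _ = (2 * ((X ×ˢ X).image fun q => q.1 + y * q.2).card) * (E y).card := by ring
      _ ≤ _ := Nat.mul_le_mul_right _ (hsmall y hy)
  have hlow : (q + Y.card) * X.card ^ 4 ≤ q * ∑ y, (E y).card := by
    calc (q + Y.card) * X.card ^ 4 = ∑ y : F, (X.card ^ 4 + if y ∈ Y then X.card ^ 4 else 0) := by
          rw [Finset.sum_add_distrib, Finset.sum_ite_mem, Finset.univ_inter, Finset.sum_const,
            Finset.sum_const, Finset.card_univ, hq]
          simp only [smul_eq_mul]; ring
      _ ≤ ∑ y : F, q * (E y).card := by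
          refine Finset.sum_le_sum fun y _ => ?_
          by_cases hy : y ∈ Y
          · have := hE2 y hy
            simp only [hy, if_true]; omega
          · simpa [hy] using hE1 y
      _ = _ := by rw [Finset.mul_sum]
  -- In a + yb = c + yd, either b = d and then a = c, or the quadruple determines y.
  have hup : ∑ y, (E y).card ≤ q * X.card ^ 2 + X.card ^ 4 := by
    rw [← Finset.card_sigma]
    let D := (Finset.univ : Finset F) ×ˢ (X ×ˢ X)
    let Q := (X ×ˢ X) ×ˢ (X ×ˢ X)
    let g : (Σ _ : F, (F × F) × (F × F)) → (F × (F × F)) ⊕ ((F × F) × (F × F)) := fun r =>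
      if r.2.1.2 = r.2.2.2 then Sum.inl (r.1, r.2.1) else Sum.inr r.2
    have hcard : (D.disjSum Q).card = q * X.card ^ 2 + X.card ^ 4 := by
      simp only [D, Q, Finset.card_disjSum, Finset.card_product, Finset.card_univ]
      rw [hq]
      ring
    rw [← hcard]
    apply Finset.card_le_card_of_injOn g
    · rintro ⟨y, ⟨a, b⟩, c, d⟩ hr
      simp only [E, Finset.coe_sigma, Set.mem_sigma_iff, Finset.mem_coe, Finset.mem_filter,
        Finset.mem_product] at hr
      simp only [g]
      split_ifs
      · simp [D, hr.2.1.1]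
      · simp [Q, hr.2.1.1, hr.2.1.2]
    · rintro ⟨y, ⟨a, b⟩, c, d⟩ hr ⟨y', ⟨a', b'⟩, c', d'⟩ hr' heq
      simp only [E, Finset.coe_sigma, Set.mem_sigma_iff, Finset.mem_coe, Finset.mem_filter,
        Finset.mem_product] at hr hr'
      have e := hr.2.2
      have e' := hr'.2.2
      simp only [g] at heq
      split_ifs at heq with h1 h2
      · simp only [Sum.inl.injEq, Prod.mk.injEq] at heq
        obtain ⟨rfl, rfl, rfl⟩ := heq
        subst h1
        subst h2
        obtain rfl := add_right_cancel e
        obtain rfl := add_right_cancel e'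
        rfl
      · simp only [Sum.inr.injEq, Prod.mk.injEq] at heq
        obtain ⟨⟨rfl, rfl⟩, rfl, rfl⟩ := heq
        have : y = y' := by
          apply mul_right_cancel₀ (sub_ne_zero.2 h1)
          linear_combination e - e'
        rw [this]
  have hfin : (q + Y.card) * X.card ^ 4 ≤ q * (q * X.card ^ 2 + X.card ^ 4) :=
    hlow.trans (Nat.mul_le_mul_left _ hup)
  have hX : 0 < X.card ^ 2 := by
    rcases Nat.eq_zero_or_pos (X.card ^ 2) with h0 | h0
    · rw [h0] at h; simp at h
    · exact h0
  have : q ^ 2 * X.card ^ 2 < Y.card * X.card ^ 2 * X.card ^ 2 := Nat.mul_lt_mul_of_pos_right h hX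
  nlinarith

/-- Upper unitriangular matrices. -/
def upper (x : F) : SLTwo F := ⟨!![1, x; 0, 1], by simp [Matrix.det_fin_two_of]⟩

/-- Lower unitriangular matrices. -/
def lower (x : F) : SLTwo F := ⟨!![1, 0; x, 1], by simp [Matrix.det_fin_two_of]⟩

omit [Fintype F] [DecidableEq F] in
lemma upper_mul (x y : F) : upper x * upper y = upper (x + y) := by
  apply ext_entries <;> rw [mul_entry] <;> simp [upper, add_comm]

omit [Fintype F] [DecidableEq F] in
lemma lower_mul (x y : F) : lower x * lower y = lower (x + y) := by
  apply ext_entries <;> rw [mul_entry] <;> simp [lower]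

omit [Fintype F] [DecidableEq F] in
lemma conj_upper {b : SLTwo F} (hb : b 1 0 = 0) (x : F) :
    b * upper x * b⁻¹ = upper (b 0 0 ^ 2 * x) := by
  have hd := det_eq b
  rw [hb, mul_zero, sub_zero] at hd
  rw [mul_inv_eq_iff_eq_mul]
  apply ext_entries <;> rw [mul_entry, mul_entry] <;> simp [upper, hb]
  linear_combination -b 0 0 * x * hd

omit [Fintype F] [DecidableEq F] in
/-- A decomposition of `SL₂` into unitriangular factors. -/
lemma exists_unitriangular_factors (g : SLTwo F) :
    ∃ x y z w : F, g = upper x * lower y * upper z * lower w := by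
  have key : ∀ g : SLTwo F, g 1 0 ≠ 0 → ∃ x y z : F, g = upper x * lower y * upper z := by
    intro g hg
    refine ⟨(g 0 0 - 1) / g 1 0, g 1 0, (g 1 1 - 1) / g 1 0, ?_⟩
    have hd := det_eq g
    apply ext_entries <;> rw [mul_entry, mul_entry, mul_entry] <;> simp [upper, lower] <;> field_simp
    · ring
    · linear_combination -hd
    · ring
  by_cases hg : g 1 0 = 0
  · have hd := det_eq g
    rw [hg, mul_zero, sub_zero] at hd
    have h1 : (g * lower (1 : F)) 1 0 ≠ 0 := by
      rw [mul_entry]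
      simp only [lower, Matrix.of_apply, Matrix.cons_val', Matrix.cons_val_zero,
        Matrix.cons_val_one, Matrix.cons_val_fin_one, hg]
      simpa using right_ne_zero_of_mul_eq_one hd
    obtain ⟨x, y, z, h⟩ := key _ h1
    refine ⟨x, y, z, -1, ?_⟩
    rw [← h, mul_assoc, lower_mul]
    have : lower ((1 : F) + -1) = 1 := by
      apply ext_entries <;> simp [lower]
    rw [this, mul_one]
  · obtain ⟨x, y, z, h⟩ := key g hg
    refine ⟨x, y, z, 0, ?_⟩
    have : lower (0 : F) = 1 := by
      apply ext_entries <;> simp [lower]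
    rw [← h, this, mul_one]

omit [Fintype F] in
lemma inv_mul_mem_sq {A : Finset (SLTwo F)} (hinv : A⁻¹ = A) {a b : SLTwo F} (ha : a ∈ A)
    (hb : b ∈ A) : a⁻¹ * b ∈ A ^ 2 := by
  rw [pow_two]
  refine Finset.mul_mem_mul ?_ hb
  rw [← hinv]
  exact Finset.inv_mem_inv ha

/-- Pigeonhole on the first column: two elements sharing it differ on the right by an upper
unitriangular matrix. -/
lemma card_le_card_upper {A : Finset (SLTwo F)} (hinv : A⁻¹ = A) :
    A.card ≤ Fintype.card F ^ 2 * (Finset.univ.filter fun x : F => upper x ∈ A ^ 2).card := by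
  have := Finset.card_le_mul_card_image_of_maps_to (s := A)
    (t := (Finset.univ : Finset (F × F))) (f := fun a => (a 0 0, a 1 0)) (fun a _ => Finset.mem_univ _)
    (Finset.univ.filter fun x : F => upper x ∈ A ^ 2).card ?_
  · rw [Finset.card_univ, Fintype.card_prod] at this
    linarith
  · rintro ⟨c, d⟩ -
    rcases (A.filter fun a => (a 0 0, a 1 0) = (c, d)).eq_empty_or_nonempty with h0 | ⟨a₀, ha₀⟩
    · rw [h0]; exact Nat.zero_le _
    rw [Finset.mem_filter, Prod.mk.injEq] at ha₀
    have hd := det_eq a₀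
    obtain ⟨i00, i01, i10, i11⟩ := inv_entries a₀
    have hform : ∀ a ∈ A.filter fun a => (a 0 0, a 1 0) = (c, d),
        a₀⁻¹ * a = upper ((a₀⁻¹ * a) 0 1) := by
      intro a ha
      rw [Finset.mem_filter, Prod.mk.injEq] at ha
      have e0 := ha.2.1.trans ha₀.2.1.symm
      have e1 := ha.2.2.trans ha₀.2.2.symm
      have hd' := det_eq a
      apply ext_entries <;> simp only [upper, mul_entry, i00, i01, i10, i11] <;> simp
      · rw [e0, e1]; linear_combination hd
      · rw [e0, e1]; ring
      · rw [← e0, ← e1]; linear_combination hd'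
    apply Finset.card_le_card_of_injOn (fun a => (a₀⁻¹ * a) 0 1)
    · intro a ha
      have ha' := (Finset.mem_filter.1 (Finset.mem_coe.1 ha)).1
      rw [Finset.mem_coe, Finset.mem_filter]
      refine ⟨Finset.mem_univ _, ?_⟩
      rw [← hform a ha]
      exact inv_mul_mem_sq hinv ha₀.1 ha'
    · intro a ha b hb h
      have := hform a ha
      simp only at h
      rw [h, ← hform b hb] at this
      exact mul_left_cancel this

/-- Pigeonhole on the q + 1 cosets of the Borel subgroup, that is on the projective line `Option F`,
finds many triangular elements in A². A given squared diagonal entry is shared by at most 2q of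
them. -/
lemma card_le_card_diag {A : Finset (SLTwo F)} (hinv : A⁻¹ = A) :
    A.card ≤ 4 * Fintype.card F ^ 2 *
      (((A ^ 2).filter fun b => b 1 0 = 0).image fun b => b 0 0 ^ 2).card := by
  obtain ⟨q, hq⟩ : ∃ q, q = Fintype.card F := ⟨_, rfl⟩
  have hq1 : 1 ≤ q := by rw [hq]; exact Fintype.card_pos
  have s1 : A.card ≤ ((A ^ 2).filter fun b => b 1 0 = 0).card * (q + 1) := by
    have := Finset.card_le_mul_card_image_of_maps_to (s := A) (t := (Finset.univ : Finset (Option F)))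
      (f := fun a => if a 1 0 = 0 then none else some (a 0 0 / a 1 0)) (fun a _ => Finset.mem_univ _)
      ((A ^ 2).filter fun b => b 1 0 = 0).card ?_
    · rwa [Finset.card_univ, Fintype.card_option, ← hq] at this
    · intro o _
      refine (Finset.eq_empty_or_nonempty _).elim
        (fun h0 => (Finset.card_eq_zero.2 h0).le.trans (Nat.zero_le _)) ?_
      rintro ⟨a₀, ha₀⟩
      rw [Finset.mem_filter] at ha₀
      apply Finset.card_le_card_of_injOn (fun a => a₀⁻¹ * a)
      · intro a ha
        rw [Finset.mem_coe, Finset.mem_filter] at ha ⊢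
        refine ⟨inv_mul_mem_sq hinv ha₀.1 ha.1, ?_⟩
        obtain ⟨i00, i01, i10, i11⟩ := inv_entries a₀
        rw [mul_entry, i10, i11]
        have h := ha.2.trans ha₀.2.symm
        by_cases h0 : a₀ 1 0 = 0
        · by_cases h1 : a 1 0 = 0
          · rw [h0, h1]; ring
          · simp [h0, h1] at h
        · by_cases h1 : a 1 0 = 0
          · simp [h0, h1] at h
          · simp only [h0, h1, if_false, Option.some.injEq] at h
            rw [div_eq_div_iff h1 h0] at h
            linear_combination -h
      · intro a _ b _ h
        exact mul_left_cancel h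
  have s2 : ((A ^ 2).filter fun b => b 1 0 = 0).card ≤
      (2 * q) * (((A ^ 2).filter fun b => b 1 0 = 0).image fun b => b 0 0 ^ 2).card := by
    refine Finset.card_le_mul_card_image _ _ fun z _ => ?_
    have hroots := card_quadratic_roots_le (F := F) 1 0 (-z) one_ne_zero
    calc _ ≤ ((Finset.univ.filter fun x : F => 1 * x ^ 2 + 0 * x + -z = 0) ×ˢ
          (Finset.univ : Finset F)).card := by
          apply Finset.card_le_card_of_injOn (fun b => (b 0 0, b 0 1))
          · intro b hb
            simp only [Finset.coe_filter, Finset.mem_filter, Set.mem_ofPred_eq] at hb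
            simp [hb.2]
          · intro b hb b' hb' h
            simp only [Finset.coe_filter, Finset.mem_filter, Set.mem_ofPred_eq] at hb hb'
            rw [Prod.mk.injEq] at h
            have d := det_eq b
            have d' := det_eq b'
            rw [hb.1.2, mul_zero, sub_zero] at d
            rw [hb'.1.2, mul_zero, sub_zero, ← h.1] at d'
            exact ext_entries h.1 h.2 (hb.1.2.trans hb'.1.2.symm)
              (mul_left_cancel₀ (left_ne_zero_of_mul_eq_one d) (d.trans d'.symm))
      _ ≤ 2 * q := by
          rw [Finset.card_product, Finset.card_univ, hq]
          exact Nat.mul_le_mul_right _ hroots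
  rw [← hq]
  generalize (((A ^ 2).filter fun b => b 1 0 = 0).image fun b => b 0 0 ^ 2).card = m at *
  calc A.card ≤ _ := s1
    _ ≤ (2 * q * m) * (q + q) := Nat.mul_le_mul s2 (by omega)
    _ = _ := by ring

/-- Conjugation by a triangular b dilates unipotents by the square of its diagonal entry, so A⁸
contains the unipotents of a set X + yX. Since this has more than q/2 elements, every s is a sum of
two of its members. The bound 4q⁸ is what makes |Y||X|² exceed q². -/
lemma upper_mem_pow {A : Finset (SLTwo F)} (hinv : A⁻¹ = A)
    (hA : 4 * Fintype.card F ^ 8 < A.card ^ 3) (s : F) : upper s ∈ A ^ 16 := by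
  set X := Finset.univ.filter fun x : F => upper x ∈ A ^ 2 with hX
  set Y := ((A ^ 2).filter fun b => b 1 0 = 0).image fun b => b 0 0 ^ 2 with hY
  have h1 : A.card ≤ Fintype.card F ^ 2 * X.card := card_le_card_upper hinv
  have h2 : A.card ≤ 4 * Fintype.card F ^ 2 * Y.card := card_le_card_diag hinv
  obtain ⟨y, hy, hbig⟩ := exists_large_dilate_sum X Y (by
    by_contra! hle
    have : A.card ^ 3 ≤ 4 * Fintype.card F ^ 8 := by
      calc A.card ^ 3 = A.card * A.card ^ 2 := by ring
        _ ≤ (4 * Fintype.card F ^ 2 * Y.card) * (Fintype.card F ^ 2 * X.card) ^ 2 :=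
          Nat.mul_le_mul h2 (Nat.pow_le_pow_left h1 2)
        _ = 4 * Fintype.card F ^ 6 * (Y.card * X.card ^ 2) := by ring
        _ ≤ 4 * Fintype.card F ^ 6 * Fintype.card F ^ 2 := Nat.mul_le_mul_left _ hle
        _ = _ := by ring
    omega)
  set W := (X ×ˢ X).image fun q => q.1 + y * q.2 with hW
  obtain ⟨b, hb, rfl⟩ := Finset.mem_image.1 hy
  rw [Finset.mem_filter] at hb
  have hWA : ∀ w ∈ W, upper w ∈ A ^ 8 := by
    intro w hw
    obtain ⟨⟨x₁, x₂⟩, hx, rfl⟩ := Finset.mem_image.1 hw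
    simp only [hX, Finset.mem_product, Finset.mem_filter, Finset.mem_univ, true_and] at hx
    rw [← upper_mul, ← conj_upper hb.2]
    have : A ^ 8 = A ^ 2 * (A ^ 2 * A ^ 2 * A ^ 2) := by simp only [← pow_add]
    rw [this]
    refine Finset.mul_mem_mul hx.1 (Finset.mul_mem_mul (Finset.mul_mem_mul hb.1 hx.2) ?_)
    have : (A ^ 2)⁻¹ = A ^ 2 := by rw [← inv_pow, hinv]
    rw [← this]
    exact Finset.inv_mem_inv hb.1
  have hmeet : ¬Disjoint W (W.image fun w => s - w) := by
    intro hd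
    have hc := Finset.card_union_of_disjoint hd
    rw [Finset.card_image_of_injective _ (sub_right_injective)] at hc
    have := Finset.card_le_univ (W ∪ W.image fun w => s - w)
    omega
  obtain ⟨w, hw, hw'⟩ := Finset.not_disjoint_iff.1 hmeet
  obtain ⟨v, hv, rfl⟩ := Finset.mem_image.1 hw'
  have : upper s = upper (s - v) * upper v := by rw [upper_mul, sub_add_cancel]
  rw [this, show A ^ 16 = A ^ 8 * A ^ 8 by rw [← pow_add]]
  exact Finset.mul_mem_mul (hWA _ hw) (hWA _ hv)

/-- A very large symmetric subset of `SL₂(F)` covers the group in boundedly many steps. -/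
theorem pow_eq_univ_of_large {A : Finset (SLTwo F)} (hinv : A⁻¹ = A)
    (hA : 4 * Fintype.card F ^ 8 < A.card ^ 3) : A ^ 64 = Finset.univ := by
  have hup := upper_mem_pow hinv hA
  have hlow : ∀ s, lower s ∈ A ^ 16 := by
    intro s
    -- The Weyl element exchanges the two unipotent subgroups; the upper case is applied to the
    -- conjugate of A.
    let w : SLTwo F := ⟨!![0, -1; 1, 0], by simp [Matrix.det_fin_two_of]⟩
    let φ : SLTwo F →* SLTwo F := (MulAut.conj w).toMonoidHom
    have hφ : Function.Injective φ := (MulAut.conj w).injective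
    have h := upper_mem_pow (A := A.image φ)
      (by
        conv_rhs => rw [← hinv]
        rw [Finset.image_inv])
      (by rwa [Finset.card_image_of_injective _ hφ]) (-s)
    rw [← Finset.image_pow] at h
    obtain ⟨g, hg, hgs⟩ := Finset.mem_image.1 h
    have : φ (lower s) = upper (-s) := by
      change w * lower s * w⁻¹ = _
      rw [mul_inv_eq_iff_eq_mul]
      apply ext_entries <;> rw [mul_entry, mul_entry] <;> simp [upper, lower, w]
    rwa [hφ (this.trans hgs.symm)]
  have h64 : A ^ (16 + 16 + 16 + 16) = A ^ 16 * A ^ 16 * A ^ 16 * A ^ 16 := by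
    rw [pow_add, pow_add, pow_add]
  rw [show 64 = 16 + 16 + 16 + 16 from rfl, h64]
  generalize A ^ 16 = B at hup hlow
  refine Finset.eq_univ_of_forall fun g => ?_
  obtain ⟨x, y, z, w, rfl⟩ := exists_unitriangular_factors g
  exact Finset.mul_mem_mul (Finset.mul_mem_mul (Finset.mul_mem_mul (hup _) (hlow _)) (hup _)) (hlow _)

end Large


/-! ### Growth of generating sets in SL₂(𝔽_p) -/

section Growth

lemma two_ne_zero_zmod {p : ℕ} (hp : 2 < p) : (2 : ZMod p) ≠ 0 := by
  intro h
  have : ((2 : ℕ) : ZMod p) = 0 := by exact_mod_cast h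
  rw [ZMod.natCast_eq_zero_iff] at this
  exact absurd (Nat.le_of_dvd (by norm_num) this) (by omega)

/-- A generating set which does not grow is very large. -/
theorem large_of_small_tripling {p : ℕ} [Fact p.Prime] {A : Finset (SLTwo (ZMod p))} (h1 : 1 ∈ A)
    (hinv : A⁻¹ = A) (hgen : Subgroup.closure (A : Set (SLTwo (ZMod p))) = ⊤) {a : ℝ} (ha : 1 ≤ a)
    (hap : a ^ 1000 ≤ p) (haA : a ^ 1000 ≤ A.card) (ha300 : 144 ≤ a ^ 300)
    (hp : 16 * 192 ^ 9 < p) (htri : ((A ^ 3).card : ℝ) ≤ a * A.card) :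
    4 * p ^ 8 < A.card ^ 3 := by
  by_contra! hsmall
  have hpR : (16 * 192 ^ 9 : ℝ) < p := by exact_mod_cast hp
  have hp2 : 2 < p := lt_of_le_of_lt (by norm_num) hp
  clear hp
  have ha0 : 0 < a := by linarith
  obtain ⟨m, hm⟩ : ∃ m : ℝ, m = (A.card : ℝ) ^ (1 / 3 : ℝ) := ⟨_, rfl⟩
  have hm0 : 0 ≤ m := by rw [hm]; positivity
  have hm3 : (A.card : ℝ) = m ^ 3 := by
    rw [hm, ← Real.rpow_natCast, ← Real.rpow_mul (by positivity)]; norm_num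
  have hma : a ^ 333 ≤ m := by
    refine le_of_pow_le_pow_left₀ (n := 3) (by norm_num) hm0 ?_
    rw [← hm3, ← pow_mul]
    exact (pow_le_pow_right₀ ha (by norm_num)).trans haA
  have h81 : 81 < A.card := by
    have : (144 : ℝ) ≤ A.card := ha300.trans ((pow_le_pow_right₀ ha (by norm_num)).trans haA)
    have : 144 ≤ A.card := by exact_mod_cast this
    omega
  have hQ : ((A ^ 48).card : ℝ) ≤ a ^ 46 * m ^ 3 := by
    rw [← hm3]
    exact Finset.small_pow_of_small_tripling (m := 48) (by norm_num) htri hinv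
  have h2c : ((A ^ 2).card : ℝ) ≤ a * m ^ 3 := by
    rw [← hm3]
    refine le_trans ?_ htri
    exact_mod_cast Finset.card_le_card (Finset.pow_subset_pow_right h1 (by norm_num))
  -- The torus bound needs 12 a^(92/3) (L + 5) < m, as |A⁴⁸| ≤ a⁴⁶ m³; the exponent is rounded up to
  -- 32. Taking L = ⌈R⌉ − 6 gives L + 5 < R, while R ≥ 12 gives R ≤ 2L.
  obtain ⟨R, hR⟩ : ∃ R, R = m / (12 * a ^ 32) := ⟨_, rfl⟩
  have hRm : m = R * (12 * a ^ 32) := by rw [hR]; field_simp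
  have hR12 : 12 ≤ R := by
    rw [hR, le_div_iff₀ (by positivity)]
    calc 12 * (12 * a ^ 32) = 144 * a ^ 32 := by ring
      _ ≤ a ^ 300 * a ^ 32 := by gcongr
      _ = a ^ 332 := by rw [← pow_add]
      _ ≤ a ^ 333 := pow_le_pow_right₀ ha (by norm_num)
      _ ≤ m := hma
  obtain ⟨L, hL⟩ : ∃ L, L = ⌈R⌉₊ - 6 := ⟨_, rfl⟩
  have hceil : 12 ≤ ⌈R⌉₊ := by
    have := hR12.trans (Nat.le_ceil R)
    exact_mod_cast this
  have hLceil : (L : ℝ) = ⌈R⌉₊ - 6 := by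
    rw [hL, Nat.cast_sub (by omega)]; norm_num
  have hLR : (L : ℝ) + 5 < R := by
    have := Nat.ceil_lt_add_one (a := R) (by linarith)
    linarith
  have hRL : R ≤ 2 * L := by
    have := Nat.le_ceil R
    linarith
  have hgrow := card_group_mul_le (L := L) (two_ne_zero_zmod hp2) h1 hinv hgen h81 (by omega) (by
    generalize (A ^ 48).card = Q at hQ
    have : (1728 * Q ^ 2 * (L + 5) ^ 3 : ℝ) < (A.card : ℝ) ^ 3 := by
      have hm3' : 0 < m ^ 3 := by
        have : 0 < m := lt_of_lt_of_le (by positivity) hma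
        positivity
      calc (1728 * Q ^ 2 * (L + 5) ^ 3 : ℝ)
          ≤ 1728 * (a ^ 46 * m ^ 3) ^ 2 * (L + 5) ^ 3 := by gcongr
        _ < 1728 * (a ^ 46 * m ^ 3) ^ 2 * R ^ 3 := by gcongr
        _ = a ^ 92 * (m ^ 3) ^ 2 * (12 * R) ^ 3 := by ring
        _ ≤ a ^ 96 * (m ^ 3) ^ 2 * (12 * R) ^ 3 := by
          gcongr
          norm_num
        _ = (m ^ 3) ^ 2 * (R * (12 * a ^ 32)) ^ 3 := by ring
        _ = (A.card : ℝ) ^ 3 := by rw [← hRm, hm3]; ring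
    exact_mod_cast this)
  have hG := card_group_ge (F := ZMod p)
  rw [ZMod.card] at hG hgrow
  have hGR : (p : ℝ) ^ 3 / 2 ≤ Fintype.card (SLTwo (ZMod p)) := by
    have : ((p - 1 : ℕ) : ℝ) * (p : ℝ) ^ 2 ≤ Fintype.card (SLTwo (ZMod p)) := by exact_mod_cast hG
    rw [Nat.cast_sub (by omega)] at this
    push_cast at this
    have h2 : (p : ℝ) / 2 ≤ p - 1 := by linarith
    have h3 : (p : ℝ) / 2 * (p : ℝ) ^ 2 ≤ ((p : ℝ) - 1) * (p : ℝ) ^ 2 := by gcongr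
    linarith [pow_succ' (p : ℝ) 2]
  have hgrowR : (Fintype.card (SLTwo (ZMod p)) : ℝ) * L ≤ 4 * p * (A ^ 2).card := by
    exact_mod_cast hgrow
  have hp0 : (0 : ℝ) < p := by linarith
  have e1 : (p : ℝ) ^ 2 * R ≤ 16 * (a * m ^ 3) := by
    have : p * ((p : ℝ) ^ 2 * R) ≤ p * (16 * (a * m ^ 3)) := by
      calc p * ((p : ℝ) ^ 2 * R) ≤ p * ((p : ℝ) ^ 2 * (2 * L)) := by gcongr
        _ = 4 * ((p : ℝ) ^ 3 / 2 * L) := by ring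
        _ ≤ 4 * (4 * p * (A ^ 2).card) := 
          mul_le_mul_of_nonneg_left
            ((mul_le_mul_of_nonneg_right hGR (Nat.cast_nonneg L)).trans hgrowR) (by norm_num)
        _ ≤ 4 * (4 * p * (a * m ^ 3)) := by gcongr
        _ = _ := by ring
    exact le_of_mul_le_mul_left this hp0
  have e2 : (p : ℝ) ^ 2 ≤ 192 * a ^ 33 * m ^ 2 := by
    have hmpos : 0 < m := lt_of_lt_of_le (by positivity) hma
    refine le_of_mul_le_mul_right ?_ hmpos
    calc (p : ℝ) ^ 2 * m = (p : ℝ) ^ 2 * R * (12 * a ^ 32) := by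
          conv_lhs => rw [hRm]
          ring
      _ ≤ 16 * (a * m ^ 3) * (12 * a ^ 32) := by gcongr
      _ = _ := by ring
  have e3 : (m ^ 9) ^ 2 ≤ (4 * (p : ℝ) ^ 8) ^ 2 := by
    have : (A.card : ℝ) ^ 3 ≤ 4 * (p : ℝ) ^ 8 := by exact_mod_cast hsmall
    rw [hm3, ← pow_mul] at this
    exact pow_le_pow_left₀ (by positivity) this 2
  -- The ninth power of p² ≤ 192 a³³ m² meets the assumed m⁹ = |A|³ ≤ 4p⁸. As a²⁹⁷ ≤ p, a factor p
  -- is left over, which bounds p.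
  have e4 : (p : ℝ) ^ 18 ≤ 192 ^ 9 * 16 * p * p ^ 16 := by
    calc (p : ℝ) ^ 18 = ((p : ℝ) ^ 2) ^ 9 := by ring
      _ ≤ (192 * a ^ 33 * m ^ 2) ^ 9 := by gcongr
      _ = 192 ^ 9 * a ^ 297 * (m ^ 9) ^ 2 := by ring
      _ ≤ 192 ^ 9 * a ^ 1000 * (4 * (p : ℝ) ^ 8) ^ 2 := by
        gcongr
        norm_num
      _ ≤ 192 ^ 9 * p * (4 * (p : ℝ) ^ 8) ^ 2 := by gcongr
      _ = _ := by ring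
  have e5 : (p : ℝ) ≤ 16 * 192 ^ 9 := by
    have : (p : ℝ) * p ^ 17 ≤ 16 * 192 ^ 9 * p ^ 17 := by
      calc (p : ℝ) * p ^ 17 = p ^ 18 := by ring
        _ ≤ _ := e4
        _ = _ := by ring
    exact le_of_mul_le_mul_right this (by positivity)
  linarith

lemma card_group_le (p : ℕ) [Fact p.Prime] : Fintype.card (SLTwo (ZMod p)) ≤ p ^ 4 := by
  have h : Fintype.card (SLTwo (ZMod p)) ≤ Fintype.card (Matrix (Fin 2) (Fin 2) (ZMod p)) :=
    Fintype.card_le_of_injective _ Subtype.val_injective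
  have h2 : Fintype.card (Matrix (Fin 2) (Fin 2) (ZMod p)) = p ^ 4 := by
    have : Fintype.card (Fin 2 → Fin 2 → ZMod p) = p ^ 4 := by
      simp [ZMod.card, ← pow_mul]
    rw [← this]
    exact Fintype.card_congr (Equiv.refl _)
  omega

/-- Growth: a symmetric generating set of `SL₂(𝔽_p)` of size at least `p ^ δ` covers the whole group
in a number of steps depending only on `δ`. -/
theorem exists_pow_eq_univ (δ : ℝ) (hδ : 0 < δ) : ∃ k p₀ : ℕ, ∀ p : ℕ, ∀ _ : Fact p.Prime, p₀ ≤ p →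
    ∀ A : Finset (SLTwo (ZMod p)), 1 ∈ A → A⁻¹ = A →
      Subgroup.closure (A : Set (SLTwo (ZMod p))) = ⊤ → (p : ℝ) ^ δ ≤ A.card →
      A ^ k = Finset.univ := by
  wlog hδ1 : δ ≤ 1 generalizing δ
  · obtain ⟨k, p₀, h⟩ := this 1 one_pos le_rfl
    refine ⟨k, p₀, fun p hp hp₀ A h1 hinv hgen hA => h p hp hp₀ A h1 hinv hgen (le_trans ?_ hA)⟩
    push Not at hδ1
    exact Real.rpow_le_rpow_of_exponent_le (by exact_mod_cast hp.out.one_le) hδ1.le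
  -- With a = p^(δ/1000), growing 1000N times would give at least p^(δN) ≥ p⁵ elements, more than
  -- the group has. The bound P ensures a³⁰⁰ ≥ 144.
  obtain ⟨N, hN⟩ := exists_nat_ge (5 / δ)
  obtain ⟨P, hP⟩ := exists_nat_ge ((144 : ℝ) ^ (10 / (3 * δ)))
  refine ⟨3 ^ (1000 * N) * 64, max P (16 * 192 ^ 9 + 1), fun p hp hp₀ A h1 hinv hgen hA => ?_⟩
  have hpbig : 16 * 192 ^ 9 < p := lt_of_lt_of_le (Nat.lt_succ_self _) ((le_max_right _ _).trans hp₀)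
  have hpP : (144 : ℝ) ^ (10 / (3 * δ)) ≤ p :=
    hP.trans (by exact_mod_cast (le_max_left _ _).trans hp₀)
  have hp1 : (1 : ℝ) < p := by exact_mod_cast hp.out.one_lt
  have hp0 : (0 : ℝ) ≤ p := by linarith
  obtain ⟨a, ha⟩ : ∃ a, a = (p : ℝ) ^ (δ / 1000) := ⟨_, rfl⟩
  have hapow : ∀ n : ℕ, a ^ n = (p : ℝ) ^ (δ * n / 1000) := by
    intro n
    rw [ha, ← Real.rpow_natCast, ← Real.rpow_mul hp0]
    ring_nf
  have ha1 : 1 ≤ a := by rw [ha]; exact Real.one_le_rpow hp1.le (by positivity)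
  have ha1000 : a ^ 1000 = (p : ℝ) ^ δ := by rw [hapow]; norm_num
  have hap : a ^ 1000 ≤ p := by
    rw [ha1000]
    calc (p : ℝ) ^ δ ≤ (p : ℝ) ^ (1 : ℝ) := Real.rpow_le_rpow_of_exponent_le hp1.le hδ1
      _ = p := Real.rpow_one _
  have ha300 : 144 ≤ a ^ 300 := by
    rw [hapow]
    calc (144 : ℝ) = ((144 : ℝ) ^ (10 / (3 * δ))) ^ (δ * (300 : ℕ) / 1000) := by
          rw [← Real.rpow_mul (by norm_num)]
          have : 10 / (3 * δ) * (δ * (300 : ℕ) / 1000) = 1 := by push_cast; field_simp; norm_num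
          rw [this, Real.rpow_one]
      _ ≤ _ := Real.rpow_le_rpow (by positivity) hpP (by positivity)
  have hpowinv : ∀ n : ℕ, (A ^ n)⁻¹ = A ^ n := fun n => by rw [← inv_pow, hinv]
  have hsub : ∀ n : ℕ, n ≠ 0 → A ⊆ A ^ n := fun n hn => Finset.subset_pow h1 hn
  have key : ∀ j : ℕ, 4 * p ^ 8 < (A ^ 3 ^ j).card ^ 3 ∨ a ^ j ≤ (A ^ 3 ^ j).card := by
    intro j
    induction j with
    | zero =>
      right
      have : 0 < A.card := Finset.card_pos.2 ⟨1, h1⟩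
      simpa using Nat.succ_le_of_lt this
    | succ j ih =>
      have hmono : A ^ 3 ^ j ⊆ A ^ 3 ^ (j + 1) :=
        Finset.pow_subset_pow_right h1 (Nat.pow_le_pow_right (by norm_num) (Nat.le_succ j))
      rcases ih with h | h
      · exact Or.inl (h.trans_le (Nat.pow_le_pow_left (Finset.card_le_card hmono) 3))
      · by_cases htri : (((A ^ 3 ^ j) ^ 3).card : ℝ) ≤ a * (A ^ 3 ^ j).card
        · left
          have hs := hsub (3 ^ j) (by positivity)
          have := large_of_small_tripling (A := A ^ 3 ^ j) (Finset.one_mem_pow h1) (hpowinv _)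
            (by
              rw [eq_top_iff, ← hgen]
              apply Subgroup.closure_mono
              exact_mod_cast hs) ha1 hap
            (by
              rw [ha1000]
              exact hA.trans (by exact_mod_cast Finset.card_le_card hs)) ha300 hpbig htri
          exact this.trans_le (Nat.pow_le_pow_left (Finset.card_le_card hmono) 3)
        · right
          push Not at htri
          rw [← pow_mul, ← pow_succ] at htri
          calc a ^ (j + 1) = a * a ^ j := pow_succ' _ _
            _ ≤ a * (A ^ 3 ^ j).card := by gcongr
            _ ≤ _ := htri.le
  rcases key (1000 * N) with h | h
  · rw [pow_mul]
    apply pow_eq_univ_of_large (hpowinv _)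
    rwa [ZMod.card]
  · exfalso
    have h4 : ((A ^ 3 ^ (1000 * N)).card : ℝ) ≤ (p : ℝ) ^ 4 := by
      exact_mod_cast (Finset.card_le_univ _).trans (card_group_le p)
    have h5 : (p : ℝ) ^ 5 ≤ a ^ (1000 * N) := by
      rw [hapow, ← Real.rpow_natCast]
      apply Real.rpow_le_rpow_of_exponent_le hp1.le
      rw [div_le_iff₀ hδ] at hN
      push_cast
      linarith
    have : (p : ℝ) ^ 4 < (p : ℝ) ^ 5 := pow_lt_pow_right₀ hp1 (by norm_num)
    linarith

end Growth


/-! ### Symmetric generating sets containing the identity -/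

section Symmetrization

variable {G : Type*} [Group G] [Finite G]

/-- The finite set `S ∪ S⁻¹ ∪ {1}`. -/
noncomputable def symmetrization (S : Set G) : Finset G := (Set.toFinite (S ∪ S⁻¹ ∪ {1})).toFinset

lemma mem_symmetrization {S : Set G} {g : G} :
    g ∈ symmetrization S ↔ (g ∈ S ∨ g⁻¹ ∈ S) ∨ g = 1 := by
  simp [symmetrization, or_comm (a := g = 1)]

lemma one_mem_symmetrization (S : Set G) : 1 ∈ symmetrization S :=
  mem_symmetrization.2 (Or.inr rfl)

variable [DecidableEq G]

lemma inv_symmetrization (S : Set G) : (symmetrization S)⁻¹ = symmetrization S := by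
  ext g
  rw [Finset.mem_inv', mem_symmetrization, mem_symmetrization, inv_inv, inv_eq_one,
    or_comm (a := g⁻¹ ∈ S)]

omit [DecidableEq G] in
lemma closure_symmetrization (S : Set G) (hS : Subgroup.closure S = ⊤) :
    Subgroup.closure (symmetrization S : Set G) = ⊤ := by
  rw [eq_top_iff, ← hS]
  exact Subgroup.closure_mono fun g hg =>
    Finset.mem_coe.2 (mem_symmetrization.2 (Or.inl (Or.inl hg)))

omit [Finite G] in
lemma exists_mem_pow_of_mem_closure {A : Finset G} (hinv : A⁻¹ = A) {g : G}
    (hg : g ∈ Subgroup.closure (A : Set G)) : ∃ n, g ∈ A ^ n := by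
  induction hg using Subgroup.closure_induction with
  | mem x hx => exact ⟨1, by simpa using hx⟩
  | one => exact ⟨0, by simp⟩
  | mul x y _ _ hx hy =>
    obtain ⟨m, hm⟩ := hx
    obtain ⟨n, hn⟩ := hy
    exact ⟨m + n, by rw [pow_add]; exact Finset.mul_mem_mul hm hn⟩
  | inv x _ hx =>
    obtain ⟨m, hm⟩ := hx
    exact ⟨m, by rw [← hinv, inv_pow]; exact Finset.inv_mem_inv hm⟩

lemma exists_pow_symmetrization_eq_univ [Fintype G] {S : Set G} (hS : Subgroup.closure S = ⊤) :
    ∃ n, symmetrization S ^ n = Finset.univ := by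
  have h : ∀ g : G, ∃ n, g ∈ symmetrization S ^ n := fun g =>
    exists_mem_pow_of_mem_closure (inv_symmetrization S)
      (by rw [closure_symmetrization S hS]; trivial)
  choose n hn using h
  refine ⟨Finset.univ.sup n, Finset.eq_univ_of_forall fun g => ?_⟩
  exact Finset.pow_subset_pow_right (one_mem_symmetrization S) (Finset.le_sup (Finset.mem_univ g))
    (hn g)

end Symmetrization

/-! ### Free pairs and injectivity of reduction on short words -/

section Girth

lemma reductionMod_apply (p : ℕ) (g : SLTwo ℤ) (i j : Fin 2) :
    reductionMod p g i j = ((g i j : ℤ) : ZMod p) := rfl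

/-- Every entry of the matrix is at most `K` in absolute value. -/
def EntriesLE (g : SLTwo ℤ) (K : ℤ) : Prop := ∀ i j, |g i j| ≤ K

lemma EntriesLE.mul {g h : SLTwo ℤ} {K L : ℤ} (hg : EntriesLE g K) (hh : EntriesLE h L) :
    EntriesLE (g * h) (2 * K * L) := by
  intro i j
  rw [Matrix.SpecialLinearGroup.coe_mul, Matrix.mul_apply, Fin.sum_univ_two]
  have hK : 0 ≤ K := (abs_nonneg _).trans (hg i 0)
  calc |g i 0 * h 0 j + g i 1 * h 1 j| ≤ |g i 0| * |h 0 j| + |g i 1| * |h 1 j| := by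
        rw [← abs_mul, ← abs_mul]; exact abs_add_le _ _
    _ ≤ K * L + K * L := by
        gcongr
        · exact hg i 0
        · exact hh 0 j
        · exact hg i 1
        · exact hh 1 j
    _ = 2 * K * L := by ring

lemma eq_of_reductionMod_eq {p : ℕ} {g h : SLTwo ℤ} {K : ℤ} (hg : EntriesLE g K)
    (hh : EntriesLE h K) (hK : 2 * K < p) (heq : reductionMod p g = reductionMod p h) : g = h := by
  apply Subtype.ext
  ext i j
  have he : reductionMod p g i j = reductionMod p h i j := by rw [heq]
  rw [reductionMod_apply, reductionMod_apply, ZMod.intCast_eq_intCast_iff_dvd_sub] at he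
  have habs : |h i j - g i j| < p := by
    calc |h i j - g i j| ≤ |h i j| + |g i j| := abs_sub _ _
      _ ≤ K + K := add_le_add (hh i j) (hg i j)
      _ < p := by linarith
  have := Int.eq_zero_of_abs_lt_dvd he habs
  linarith

/-- The value of a positive word in two elements of a monoid. -/
def positiveWord {M : Type*} [Monoid M] (x y : M) (l : List Bool) : M :=
  (l.map fun b => if b then y else x).prod

lemma entriesLE_positiveWord {x y : SLTwo ℤ} {M : ℤ} (hx : EntriesLE x M)
    (hy : EntriesLE y M) (l : List Bool) : EntriesLE (positiveWord x y l) ((2 * M) ^ l.length) := by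
  induction l with
  | nil =>
    intro i j
    fin_cases i <;> fin_cases j <;> simp [positiveWord]
  | cons b l ih =>
    have hb : EntriesLE (if b then y else x) M := by split_ifs <;> assumption
    have := hb.mul ih
    rw [List.length_cons, pow_succ']
    exact this

/-- The binary number with the given digits. -/
def binaryValue : List Bool → ℕ
  | [] => 0
  | b :: l => 2 * binaryValue l + b.toNat

lemma binaryValue_injective : ∀ l l' : List Bool, l.length = l'.length →
    binaryValue l = binaryValue l' → l = l'
  | [], [], _, _ => rfl
  | [], _ :: _, h, _ => by simp at h
  | _ :: _, [], h, _ => by simp at h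
  | b :: l, b' :: l', hlen, h => by
    simp only [binaryValue] at h
    have hb : b = b' := by
      cases b <;> cases b' <;> simp at h ⊢ <;> omega
    subst hb
    rw [binaryValue_injective l l' (by simpa using hlen) (by omega)]

/-- The affine map `t ↦ 2 t + c`. -/
def doubling (c : ℚ) : Equiv.Perm ℚ where
  toFun t := 2 * t + c
  invFun t := (t - c) / 2
  left_inv t := by ring
  right_inv t := by ring

/-- Horner's scheme; it lets words of equal length be told apart by their action on 0. -/
lemma positiveWord_doubling (l : List Bool) :
    positiveWord (doubling 0) (doubling 1) l 0 = binaryValue l := by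
  induction l with
  | nil => simp [positiveWord, binaryValue]
  | cons b l ih =>
    have : positiveWord (doubling 0) (doubling 1) (b :: l) =
        (if b then doubling 1 else doubling 0) * positiveWord (doubling 0) (doubling 1) l := by
      simp [positiveWord]
    rw [this, Equiv.Perm.mul_apply, ih]
    cases b <;> simp [doubling, binaryValue]

/-- A noncommutative free group contains two elements whose positive words of any given length are
pairwise distinct. -/
lemma exists_free_pair {H : Type*} [Group H] [IsFreeGroup H] (hH : ∃ g h : H, g * h ≠ h * g) :
    ∃ x y : H, ∀ l l' : List Bool, l.length = l'.length →
      positiveWord x y l = positiveWord x y l' → l = l' := by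
  have b := IsFreeGroup.basis H
  -- A free group on at most one generator is trivial or cyclic, hence commutative.
  have hnt : Nontrivial (IsFreeGroup.Generators H) := by
    by_contra hnt
    rw [not_nontrivial_iff_subsingleton] at hnt
    obtain ⟨g, h, hgh⟩ := hH
    apply hgh
    rcases isEmpty_or_nonempty (IsFreeGroup.Generators H) with hE | ⟨⟨i⟩⟩
    · have : Subsingleton H := b.repr.toEquiv.subsingleton
      exact Subsingleton.elim _ _
    · have hz : ∀ w : FreeGroup (IsFreeGroup.Generators H), w ∈ Subgroup.zpowers (FreeGroup.of i) := by
        intro w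
        have : w ∈ Subgroup.closure (Set.range (FreeGroup.of (α := IsFreeGroup.Generators H))) := by
          rw [FreeGroup.closure_range_of]; trivial
        refine (Subgroup.closure_le _).2 ?_ this
        rintro _ ⟨j, rfl⟩
        rw [Subsingleton.elim j i]
        exact Subgroup.mem_zpowers _
      obtain ⟨m, hm⟩ := Subgroup.mem_zpowers_iff.1 (hz (b.repr g))
      obtain ⟨n, hn⟩ := Subgroup.mem_zpowers_iff.1 (hz (b.repr h))
      apply b.repr.injective
      rw [map_mul, map_mul, ← hm, ← hn, ← _root_.zpow_add, ← _root_.zpow_add, add_comm]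
  obtain ⟨i, j, hij⟩ := hnt
  classical
  -- Freeness allows any images of the basis: t ↦ 2t for i and t ↦ 2t + 1 for all others.
  let φ : H →* Equiv.Perm ℚ :=
    (FreeGroup.lift fun k => if k = i then doubling 0 else doubling 1).comp b.repr.toMonoidHom
  have hi : φ (b i) = doubling 0 := by simp [φ]
  have hj : φ (b j) = doubling 1 := by simp [φ, hij.symm]
  refine ⟨b i, b j, fun l l' hlen heq => binaryValue_injective l l' hlen ?_⟩
  have hφ : ∀ l, φ (positiveWord (b i) (b j) l) = positiveWord (doubling 0) (doubling 1) l := by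
    intro l
    rw [positiveWord, map_list_prod, List.map_map, positiveWord]
    congr 2
    funext c
    cases c <;> simp [hi, hj]
  have h0 := congrArg (fun g => φ g 0) heq
  simp only [hφ, positiveWord_doubling] at h0
  exact_mod_cast h0

end Girth


/-! ### From girth and growth to the diameter -/

section Diameter

lemma exists_noncommuting {A : Set (SLTwo ℤ)} {p : ℕ} [Fact p.Prime]
    (h : Subgroup.closure (reductionMod p '' A) = ⊤) :
    ∃ g h : Subgroup.closure A, g * h ≠ h * g := by
  by_contra! hcomm
  rw [← MonoidHom.map_closure] at h
  obtain ⟨g, hg, hg'⟩ : (upper 1 : SLTwo (ZMod p)) ∈ (Subgroup.closure A).map (reductionMod p) := by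
    rw [h]; trivial
  obtain ⟨k, hk, hk'⟩ : (lower 1 : SLTwo (ZMod p)) ∈ (Subgroup.closure A).map (reductionMod p) := by
    rw [h]; trivial
  have e : g * k = k * g := congrArg Subtype.val (hcomm ⟨g, hg⟩ ⟨k, hk⟩)
  have e1 : (upper 1 : SLTwo (ZMod p)) * lower 1 = lower 1 * upper 1 := by
    rw [← hg', ← hk', ← map_mul, e, map_mul]
  have e2 : (upper 1 * lower 1 : SLTwo (ZMod p)) 0 0 = (lower 1 * upper 1 : SLTwo (ZMod p)) 0 0 := by
    rw [e1]
  rw [mul_entry, mul_entry] at e2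
  simp [upper, lower] at e2

/-- The length m comes from a word over ℤ and so does not depend on p. -/
lemma exists_reductionMod_mem_pow (A : Set (SLTwo ℤ)) {g : SLTwo ℤ} (hg : g ∈ Subgroup.closure A) :
    ∃ m : ℕ, ∀ p : ℕ, ∀ _ : Fact p.Prime,
      reductionMod p g ∈ symmetrization (reductionMod p '' A) ^ m := by
  induction hg using Subgroup.closure_induction with
  | mem x hx =>
    exact ⟨1, fun p _ => by
      rw [pow_one]; exact mem_symmetrization.2 (Or.inl (Or.inl ⟨x, hx, rfl⟩))⟩
  | one => exact ⟨0, fun p _ => by simp⟩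
  | mul x y _ _ hx hy =>
    obtain ⟨m, hm⟩ := hx
    obtain ⟨n, hn⟩ := hy
    exact ⟨m + n, fun p hp => by
      rw [pow_add, map_mul]; exact Finset.mul_mem_mul (hm p hp) (hn p hp)⟩
  | inv x _ hx =>
    obtain ⟨m, hm⟩ := hx
    exact ⟨m, fun p hp => by
      rw [← inv_symmetrization, inv_pow, map_inv]; exact Finset.inv_mem_inv (hm p hp)⟩

lemma positiveWord_mem_pow {G : Type*} [Group G] [DecidableEq G] {T : Finset G} {x y : G}
    (hx : x ∈ T) (hy : y ∈ T) (l : List Bool) : positiveWord x y l ∈ T ^ l.length := by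
  induction l with
  | nil => simp [positiveWord]
  | cons b l ih =>
    have hb : (if b then y else x) ∈ T := by split_ifs <;> assumption
    rw [List.length_cons, pow_succ']
    exact Finset.mul_mem_mul hb ih

/-- Logarithmic girth: short words in the reduction of a free group already form a set of size a
fixed power of `p`. -/
lemma exists_large_ball {A : Set (SLTwo ℤ)} (hA : IsFreeGroup (Subgroup.closure A))
    (hnc : ∃ g h : Subgroup.closure A, g * h ≠ h * g) :
    ∃ δ : ℝ, 0 < δ ∧ ∃ c p₁ : ℕ, ∀ p : ℕ, ∀ _ : Fact p.Prime, p₁ ≤ p → ∃ n : ℕ, n ≠ 0 ∧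
      (n : ℝ) ≤ c * Real.log p ∧
      (p : ℝ) ^ δ ≤ (symmetrization (reductionMod p '' A) ^ n).card := by
  obtain ⟨x, y, hxy⟩ := exists_free_pair hnc
  obtain ⟨mx, hmx⟩ := exists_reductionMod_mem_pow A x.2
  obtain ⟨my, hmy⟩ := exists_reductionMod_mem_pow A y.2
  obtain ⟨m, hm⟩ : ∃ m, m = mx + my + 1 := ⟨_, rfl⟩
  have hword : ∀ l : List Bool, ((positiveWord x y l : Subgroup.closure A) : SLTwo ℤ) =
      positiveWord (x : SLTwo ℤ) (y : SLTwo ℤ) l := by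
    intro l
    rw [positiveWord, positiveWord, ← Subgroup.coe_subtype, map_list_prod, List.map_map]
    congr 2
    funext b
    cases b <;> simp
  obtain ⟨M, hM2, hMx, hMy⟩ : ∃ M : ℕ, 2 ≤ M ∧ EntriesLE (x : SLTwo ℤ) M ∧
      EntriesLE (y : SLTwo ℤ) M := by
    refine ⟨2 + ∑ i, ∑ j, ((x : SLTwo ℤ) i j).natAbs + ∑ i, ∑ j, ((y : SLTwo ℤ) i j).natAbs,
      by omega, ?_, ?_⟩ <;>
    · intro i j
      rw [Int.abs_eq_natAbs]
      norm_cast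
      fin_cases i <;> fin_cases j <;> simp [Fin.sum_univ_two] <;> omega
  have hK1 : 1 < 2 * M := by omega
  have hlogK : 0 < Real.log ((2 * M : ℕ) : ℝ) := Real.log_pos (by exact_mod_cast hK1)
  have hlog2 : 0 < Real.log 2 := Real.log_pos (by norm_num)
  -- The word length n satisfies (2M)^(n+1) ≤ p < (2M)^(n+2) ≤ (2M)^(3n), whence δ from the 2ⁿ
  -- words; the spare factor 2M > 2 covers the difference of two entries. The threshold (2M)² makes
  -- n ≥ 1, and c = 2m uses log 2 ≥ 1/2.
  refine ⟨Real.log 2 / (3 * Real.log ((2 * M : ℕ) : ℝ)), by positivity, 2 * m, (2 * M) ^ 2,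
    fun p hp hp₁ => ?_⟩
  have hp0 : p ≠ 0 := hp.out.ne_zero
  obtain ⟨n, hn⟩ : ∃ n, Nat.log (2 * M) p = n + 1 ∧ n ≠ 0 := by
    have : 2 ≤ Nat.log (2 * M) p := by
      exact (Nat.le_log_iff_pow_le hK1 hp0).2 hp₁
    exact ⟨Nat.log (2 * M) p - 1, by omega, by omega⟩
  obtain ⟨hn, hn0⟩ := hn
  have hle : (2 * M) ^ (n + 1) ≤ p := by rw [← hn]; exact Nat.pow_log_le_self _ hp0
  have hlt : p < (2 * M) ^ (n + 2) := by
    have := Nat.lt_pow_succ_log_self hK1 p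
    rwa [hn] at this
  have hp1 : (1 : ℝ) < p := by exact_mod_cast hp.out.one_lt
  refine ⟨m * n, mul_ne_zero (by omega) hn0, ?_, ?_⟩
  · have h2n : (2 : ℝ) ^ n ≤ p := by
      have : 2 ^ n ≤ p := by
        calc 2 ^ n ≤ (2 * M) ^ n := Nat.pow_le_pow_left (by omega) n
          _ ≤ (2 * M) ^ (n + 1) := Nat.pow_le_pow_right (by omega) (Nat.le_succ n)
          _ ≤ p := hle
      exact_mod_cast this
    have hl : (n : ℝ) * Real.log 2 ≤ Real.log p := by
      rw [← Real.log_pow]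
      exact Real.log_le_log (by positivity) h2n
    have h12 : (1 : ℝ) / 2 ≤ Real.log 2 := by linarith [Real.log_two_gt_d9]
    have : (n : ℝ) ≤ 2 * Real.log p := by nlinarith [Nat.cast_nonneg (α := ℝ) n]
    push_cast
    calc (m : ℝ) * n ≤ m * (2 * Real.log p) := by gcongr
      _ = 2 * m * Real.log p := by ring
  · have hcard : 2 ^ n ≤ (symmetrization (reductionMod p '' A) ^ (m * n)).card := by
      have hv : 2 ^ n = (Finset.univ : Finset (List.Vector Bool n)).card := by
        rw [Finset.card_univ, card_vector, Fintype.card_bool]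
      rw [hv]
      have hsub : ∀ k, k ≤ m → symmetrization (reductionMod p '' A) ^ k ⊆
          symmetrization (reductionMod p '' A) ^ m := fun k hk =>
        Finset.pow_subset_pow_right (one_mem_symmetrization _) hk
      have hred : ∀ l, reductionMod p (positiveWord (x : SLTwo ℤ) (y : SLTwo ℤ) l) =
          positiveWord (reductionMod p x) (reductionMod p y) l := by
        intro l
        rw [positiveWord, positiveWord, map_list_prod, List.map_map]
        congr 2
        funext b
        cases b <;> simp
      apply Finset.card_le_card_of_injOn
        (fun l => reductionMod p (positiveWord (x : SLTwo ℤ) (y : SLTwo ℤ) l.1))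
      · intro l _
        simp only
        rw [hred, Finset.mem_coe, pow_mul]
        have := positiveWord_mem_pow (hsub mx (by omega) (hmx p hp)) (hsub my (by omega) (hmy p hp)) l.1
        rwa [l.2] at this
      · intro l _ l' _ heq
        apply Subtype.ext
        apply hxy _ _ (l.2.trans l'.2.symm)
        apply Subtype.ext
        rw [hword, hword]
        have b1 := entriesLE_positiveWord hMx hMy l.1
        have b2 := entriesLE_positiveWord hMx hMy l'.1
        rw [l.2] at b1
        rw [l'.2] at b2
        refine eq_of_reductionMod_eq b1 b2 ?_ heq
        have : 2 * (2 * M) ^ n < p := by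
          calc 2 * (2 * M) ^ n < (2 * M) * (2 * M) ^ n :=
                Nat.mul_lt_mul_of_pos_right (by omega) (by positivity)
            _ = (2 * M) ^ (n + 1) := (pow_succ' _ _).symm
            _ ≤ p := hle
        exact_mod_cast this
    refine le_trans ?_ (show ((2 ^ n : ℕ) : ℝ) ≤ _ by exact_mod_cast hcard)
    have hp3 : (p : ℝ) ≤ ((2 * M : ℕ) : ℝ) ^ (3 * n) := by
      have : p ≤ (2 * M) ^ (3 * n) :=
        hlt.le.trans (Nat.pow_le_pow_right (by omega) (by omega))
      exact_mod_cast this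
    have hlogp : Real.log p ≤ (3 * n : ℕ) * Real.log ((2 * M : ℕ) : ℝ) := by
      rw [← Real.log_pow]
      exact Real.log_le_log (by linarith) hp3
    rw [← Real.log_le_log_iff (by positivity) (by positivity), Real.log_rpow (by linarith)]
    push_cast at hlogp hlogK ⊢
    rw [Real.log_pow, div_mul_eq_mul_div, div_le_iff₀ (by positivity)]
    nlinarith

theorem exists_symmetrization_pow_eq_univ {A : Set (SLTwo ℤ)}
    (hA : IsFreeGroup (Subgroup.closure A)) : ∃ C : ℝ, 0 < C ∧ ∀ p : ℕ, ∀ _ : Fact p.Prime,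
      Subgroup.closure (reductionMod p '' A) = ⊤ → ∃ N : ℕ, (N : ℝ) ≤ C * Real.log p ∧
        symmetrization (reductionMod p '' A) ^ N = Finset.univ := by
  classical
  by_cases hnc : ∃ g h : Subgroup.closure A, g * h ≠ h * g
  swap
  · exact ⟨1, one_pos, fun p _ hgen => absurd (exists_noncommuting hgen) hnc⟩
  obtain ⟨δ, hδ, c, p₁, hball⟩ := exists_large_ball hA hnc
  obtain ⟨k, p₀, hgrow⟩ := exists_pow_eq_univ δ hδ
  have hsmall : ∀ p : ℕ, ∃ d : ℕ, ∀ _ : Fact p.Prime, Subgroup.closure (reductionMod p '' A) = ⊤ →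
      symmetrization (reductionMod p '' A) ^ d = Finset.univ := by
    intro p
    by_cases h : ∃ _ : Fact p.Prime, Subgroup.closure (reductionMod p '' A) = ⊤
    · obtain ⟨hp, hgen⟩ := h
      obtain ⟨d, hd⟩ := exists_pow_symmetrization_eq_univ hgen
      exact ⟨d, fun _ _ => hd⟩
    · exact ⟨0, fun hp hgen => absurd ⟨hp, hgen⟩ h⟩
  choose d hd using hsmall
  have hlog2 : 0 < Real.log 2 := Real.log_pos (by norm_num)
  obtain ⟨D, hD⟩ : ∃ D, D = ∑ p ∈ Finset.range (max p₀ p₁), d p := ⟨_, rfl⟩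
  -- The first term serves large p. The second serves the finitely many small primes, whose
  -- exponents are all at most D.
  refine ⟨c * k + D / Real.log 2 + 1, by positivity, fun p hp hgen => ?_⟩
  have hlogp : Real.log 2 ≤ Real.log p :=
    Real.log_le_log (by norm_num) (by exact_mod_cast hp.out.two_le)
  have hlogp0 : 0 < Real.log p := hlog2.trans_le hlogp
  by_cases hpl : max p₀ p₁ ≤ p
  · obtain ⟨n, hn0, hnlog, hncard⟩ := hball p hp ((le_max_right _ _).trans hpl)
    have h1 := one_mem_symmetrization (reductionMod p '' A)
    have hpow := hgrow p hp ((le_max_left _ _).trans hpl)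
      (symmetrization (reductionMod p '' A) ^ n) (Finset.one_mem_pow h1)
      (by rw [← inv_pow, inv_symmetrization])
      (by
        rw [eq_top_iff, ← closure_symmetrization _ hgen]
        apply Subgroup.closure_mono
        exact_mod_cast Finset.subset_pow h1 hn0) hncard
    rw [← pow_mul] at hpow
    refine ⟨n * k, ?_, hpow⟩
    push_cast
    have : 0 ≤ (D : ℝ) / Real.log 2 := by positivity
    calc (n : ℝ) * k ≤ c * Real.log p * k := by gcongr
      _ = c * k * Real.log p := by ring
      _ ≤ _ := by gcongr; linarith
  · push Not at hpl
    refine ⟨d p, ?_, hd p hp hgen⟩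
    have hdD : (d p : ℝ) ≤ D := by
      rw [hD]
      exact_mod_cast Finset.single_le_sum (f := d) (fun _ _ => Nat.zero_le _) (Finset.mem_range.2 hpl)
    have h0 : (0 : ℝ) ≤ c * k := by positivity
    calc (d p : ℝ) ≤ D := hdD
      _ = D / Real.log 2 * Real.log 2 := by field_simp
      _ ≤ D / Real.log 2 * Real.log p := by gcongr
      _ ≤ _ := by gcongr; linarith

/-- If every element is a product of `N` elements of `S ∪ S⁻¹ ∪ {1}`, then the Cayley graph of `S`
is connected of diameter at most `N`. -/
lemma cayleyGraph_diam_le {G : Type*} [Group G] [Fintype G] [DecidableEq G] {S : Set G} {N : ℕ}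
    (h : symmetrization S ^ N = Finset.univ) :
    (cayleyGraph S).Connected ∧ (cayleyGraph S).diam ≤ N := by
  -- Extended distances are used so that a finite bound also yields connectedness.
  have hstep : ∀ t ∈ symmetrization S, ∀ w : G, (cayleyGraph S).edist (t * w) w ≤ 1 := by
    intro t ht w
    rw [SimpleGraph.edist_le_one_iff_adj_or_eq]
    by_cases h1 : t * w = w
    · exact Or.inr h1
    · left
      rw [cayleyGraph, SimpleGraph.fromRel_adj]
      refine ⟨h1, ?_⟩
      rcases mem_symmetrization.1 ht with (hs | hs) | hs
      · exact Or.inl ⟨t, hs, rfl⟩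
      · exact Or.inr ⟨t⁻¹, hs, by simp⟩
      · simp [hs] at h1
  have hdist : ∀ n : ℕ, ∀ g ∈ symmetrization S ^ n, ∀ w : G, (cayleyGraph S).edist (g * w) w ≤ n := by
    intro n
    induction n with
    | zero =>
      intro g hg w
      rw [pow_zero, Finset.mem_one] at hg
      simp [hg]
    | succ n ih =>
      intro g hg w
      rw [pow_succ'] at hg
      obtain ⟨t, ht, g', hg', rfl⟩ := Finset.mem_mul.1 hg
      calc (cayleyGraph S).edist (t * g' * w) w
          ≤ (cayleyGraph S).edist (t * g' * w) (g' * w) + (cayleyGraph S).edist (g' * w) w :=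
            SimpleGraph.edist_triangle
        _ ≤ 1 + n := by
            gcongr
            · rw [mul_assoc]; exact hstep t ht _
            · exact ih g' hg' w
        _ = ((n + 1 : ℕ) : ℕ∞) := by push_cast; ring
  have hediam : (cayleyGraph S).ediam ≤ N := by
    apply SimpleGraph.ediam_le_of_edist_le
    intro u v
    have := hdist N (u * v⁻¹) (by rw [h]; exact Finset.mem_univ _) v
    rwa [inv_mul_cancel_right] at this
  refine ⟨SimpleGraph.connected_of_ediam_ne_top fun htop => ?_, ?_⟩
  · rw [htop] at hediam
    simp at hediam
  · exact ENat.toNat_le_of_le_natCast hediam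

end Diameter

/-! ### The pairs of unipotents modulo p -/

section UnipotentPair

lemma reductionMod_unipotentPair (p : ℕ) [Fact p.Prime] (m : ℤ) :
    reductionMod p '' unipotentPair m = {upper (m : ZMod p), lower (m : ZMod p)} := by
  let a : SLTwo ℤ := ⟨!![1, m; 0, 1], by simp [Matrix.det_fin_two_of]⟩
  let b : SLTwo ℤ := ⟨!![1, 0; m, 1], by simp [Matrix.det_fin_two_of]⟩
  have h : reductionMod p '' unipotentPair m = {reductionMod p a, reductionMod p b} :=
    Set.image_pair (reductionMod p) a b
  have ha : reductionMod p a = upper (m : ZMod p) := by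
    apply ext_entries
    · exact (reductionMod_apply p a 0 0).trans (by simp [upper, a])
    · exact (reductionMod_apply p a 0 1).trans (by simp [upper, a])
    · exact (reductionMod_apply p a 1 0).trans (by simp [upper, a])
    · exact (reductionMod_apply p a 1 1).trans (by simp [upper, a])
  have hb : reductionMod p b = lower (m : ZMod p) := by
    apply ext_entries
    · exact (reductionMod_apply p b 0 0).trans (by simp [lower, b])
    · exact (reductionMod_apply p b 0 1).trans (by simp [lower, b])
    · exact (reductionMod_apply p b 1 0).trans (by simp [lower, b])
    · exact (reductionMod_apply p b 1 1).trans (by simp [lower, b])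
  rw [h, ha, hb]

lemma upper_pow {F : Type*} [Field F] (x : F) (n : ℕ) : upper x ^ n = upper (n * x) := by
  induction n with
  | zero =>
    rw [pow_zero]
    apply ext_entries <;> simp [upper]
  | succ n ih => rw [pow_succ, ih, upper_mul]; push_cast; ring_nf

lemma lower_pow {F : Type*} [Field F] (x : F) (n : ℕ) : lower x ^ n = lower (n * x) := by
  induction n with
  | zero =>
    rw [pow_zero]
    apply ext_entries <;> simp [lower]
  | succ n ih => rw [pow_succ, ih, lower_mul]; push_cast; ring_nf

/-- Every residue is a multiple of m, so powers of the generators exhaust both unipotent subgroups,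
which generate SL₂. -/
lemma closure_reductionMod_unipotentPair (p : ℕ) [Fact p.Prime] {m : ℤ} (hm : (m : ZMod p) ≠ 0) :
    Subgroup.closure (reductionMod p '' unipotentPair m) = ⊤ := by
  rw [reductionMod_unipotentPair]
  have hmul : ∀ s : ZMod p, ((s / m).val : ZMod p) * m = s := by
    intro s
    rw [ZMod.natCast_zmod_val, div_mul_cancel₀ _ hm]
  have hu : ∀ s : ZMod p, upper s ∈
      Subgroup.closure {upper (m : ZMod p), lower (m : ZMod p)} := by
    intro s
    rw [← hmul s, ← upper_pow]
    exact Subgroup.pow_mem _ (Subgroup.subset_closure (by simp)) _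
  have hl : ∀ s : ZMod p, lower s ∈
      Subgroup.closure {upper (m : ZMod p), lower (m : ZMod p)} := by
    intro s
    rw [← hmul s, ← lower_pow]
    exact Subgroup.pow_mem _ (Subgroup.subset_closure (by simp)) _
  rw [eq_top_iff]
  rintro g -
  obtain ⟨x, y, z, w, rfl⟩ := exists_unitriangular_factors g
  exact mul_mem (mul_mem (mul_mem (hu x) (hl y)) (hu z)) (hl w)

lemma symmetrization_unipotentPair_three_subset (p : ℕ) [Fact p.Prime] :
    symmetrization (reductionMod p '' unipotentPair 3) ⊆
      symmetrization (reductionMod p '' unipotentPair 1) ^ 3 := by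
  have hinv : (symmetrization (reductionMod p '' unipotentPair 1) ^ 3)⁻¹ =
      symmetrization (reductionMod p '' unipotentPair 1) ^ 3 := by
    rw [← inv_pow, inv_symmetrization]
  have hmem : ∀ g ∈ reductionMod p '' unipotentPair 3,
      g ∈ symmetrization (reductionMod p '' unipotentPair 1) ^ 3 := by
    intro g hg
    rw [reductionMod_unipotentPair] at hg
    rcases hg with rfl | rfl
    · have : upper ((3 : ℤ) : ZMod p) = upper ((1 : ℤ) : ZMod p) ^ 3 := by
        rw [upper_pow]; push_cast; rw [mul_one]
      rw [this]
      apply Finset.pow_mem_pow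
      refine mem_symmetrization.2 (Or.inl (Or.inl ?_))
      rw [reductionMod_unipotentPair]
      exact Set.mem_insert _ _
    · have : lower ((3 : ℤ) : ZMod p) = lower ((1 : ℤ) : ZMod p) ^ 3 := by
        rw [lower_pow]; push_cast; rw [mul_one]
      rw [this]
      apply Finset.pow_mem_pow
      refine mem_symmetrization.2 (Or.inl (Or.inl ?_))
      rw [reductionMod_unipotentPair]
      exact Set.mem_insert_of_mem _ rfl
  intro g hg
  rcases mem_symmetrization.1 hg with (h | h) | h
  · exact hmem g h
  · rw [← hinv]
    exact Finset.mem_inv'.2 (hmem _ h)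
  · rw [h]
    exact Finset.one_mem_pow (one_mem_symmetrization _)

end UnipotentPair


/-! ### Ping-pong for the shears by 3 -/

section PingPong

/-- The unipotent matrix `(1 3; 0 1)` or `(1 0; 3 1)`. -/
def shear (i : Fin 2) : SLTwo ℤ :=
  if i = 0 then ⟨!![1, 3; 0, 1], by simp [Matrix.det_fin_two_of]⟩
  else ⟨!![1, 0; 3, 1], by simp [Matrix.det_fin_two_of]⟩

/-- The linear automorphism attached to `shear i`. -/
noncomputable def shearEquiv (i : Fin 2) : (Fin 2 → ℤ) ≃ₗ[ℤ] (Fin 2 → ℤ) :=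
  Matrix.SpecialLinearGroup.toLin' (shear i)

lemma shearEquiv_zero_apply (v : Fin 2 → ℤ) : shearEquiv 0 v = ![v 0 + 3 * v 1, v 1] := by
  have h : shearEquiv 0 v = !![(1 : ℤ), 3; 0, 1] *ᵥ v := rfl
  rw [h]
  ext i
  fin_cases i <;> simp [mulVec, dotProduct, Fin.sum_univ_two]

lemma shearEquiv_one_apply (v : Fin 2 → ℤ) : shearEquiv 1 v = ![v 0, 3 * v 0 + v 1] := by
  have h : shearEquiv 1 v = !![(1 : ℤ), 0; 3, 1] *ᵥ v := rfl
  rw [h]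
  ext i
  fin_cases i <;> simp [mulVec, dotProduct, Fin.sum_univ_two]

/-- The nonzero vectors in the orbit of the first basis vector. -/
abbrev PrimitiveVector : Type :=
  MulAction.orbit ((Fin 2 → ℤ) ≃ₗ[ℤ] (Fin 2 → ℤ)) (![1, 0] : Fin 2 → ℤ)

lemma PrimitiveVector.ne_zero (v : PrimitiveVector) : ¬(v.1 0 = 0 ∧ v.1 1 = 0) := by
  rintro ⟨h0, h1⟩
  obtain ⟨g, hg⟩ := v.2
  have hv : v.1 = 0 := by
    ext i
    fin_cases i <;> assumption
  rw [hv] at hg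
  have : (![1, 0] : Fin 2 → ℤ) = 0 := g.injective (by simp at hg)
  simpa using congrFun this 0

/-- The attracting regions of the two shears. -/
def attracting (i : Fin 2) : Set PrimitiveVector :=
  {v | |v.1 (1 - i)| < |v.1 i| ∧ 0 ≤ v.1 0 * v.1 1}

/-- The attracting regions of the inverses of the two shears. -/
def repelling (i : Fin 2) : Set PrimitiveVector :=
  {v | |v.1 (1 - i)| < |v.1 i| ∧ v.1 0 * v.1 1 < 0}

/-- For y > 0 the exclusion forces x ≥ −y, so x + 3y ≥ 2y > y; y < 0 is symmetric. A shear by 2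
would only give a weak inequality. -/
lemma abs_lt_abs_add {x y : ℤ} (h : ¬(|y| < |x| ∧ x * y < 0)) (h0 : ¬(x = 0 ∧ y = 0)) :
    |y| < |x + 3 * y| ∧ 0 ≤ (x + 3 * y) * y := by
  rcases lt_trichotomy y 0 with hy | rfl | hy
  · have hx : x ≤ -y := by
      by_contra! hx
      exact h ⟨by rw [abs_of_neg hy, abs_of_pos (by linarith)]; exact hx,
        mul_neg_of_pos_of_neg (by linarith) hy⟩
    have hneg : x + 3 * y < 0 := by linarith
    exact ⟨by rw [abs_of_neg hy, abs_of_neg hneg]; linarith, (mul_pos_of_neg_of_neg hneg hy).le⟩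
  · have hx : x ≠ 0 := fun hx => h0 ⟨hx, rfl⟩
    simpa using hx
  · have hx : -y ≤ x := by
      by_contra! hx
      exact h ⟨by rw [abs_of_pos hy, abs_of_neg (by linarith)]; linarith,
        mul_neg_of_neg_of_pos (by linarith) hy⟩
    have hpos : 0 < x + 3 * y := by linarith
    exact ⟨by rw [abs_of_pos hy, abs_of_pos hpos]; linarith, (mul_pos hpos hy).le⟩

/-- Mirror image of the previous estimate. The boundary y = 0 lies in the excluded region, so the
sign condition can be strict. -/
lemma abs_lt_abs_sub {x y : ℤ} (h : ¬(|y| < |x| ∧ 0 ≤ x * y)) (h0 : ¬(x = 0 ∧ y = 0)) :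
    |y| < |x - 3 * y| ∧ (x - 3 * y) * y < 0 := by
  rcases lt_trichotomy y 0 with hy | rfl | hy
  · have hx : y ≤ x := by
      by_contra! hx
      exact h ⟨by rw [abs_of_neg hy, abs_of_neg (by linarith)]; linarith,
        (mul_pos_of_neg_of_neg (by linarith) hy).le⟩
    have hpos : 0 < x - 3 * y := by linarith
    exact ⟨by rw [abs_of_neg hy, abs_of_pos hpos]; linarith, mul_neg_of_pos_of_neg hpos hy⟩
  · exfalso
    have hx : x ≠ 0 := fun hx => h0 ⟨hx, rfl⟩
    exact h ⟨by simpa using hx, by simp⟩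
  · have hx : x ≤ y := by
      by_contra! hx
      exact h ⟨by rw [abs_of_pos hy, abs_of_pos (by linarith)]; exact hx,
        (mul_pos (by linarith) hy).le⟩
    have hneg : x - 3 * y < 0 := by linarith
    exact ⟨by rw [abs_of_pos hy, abs_of_neg hneg]; linarith, mul_neg_of_neg_of_pos hneg hy⟩

lemma injective_lift_shear : Function.Injective (FreeGroup.lift shear) := by
  have smul_val : ∀ (g : (Fin 2 → ℤ) ≃ₗ[ℤ] (Fin 2 → ℤ)) (v : PrimitiveVector),
      (g • v).1 = g v.1 := fun _ _ => rfl
  have hdisj : ∀ i j : Fin 2, i ≠ j → ∀ v : PrimitiveVector,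
      |v.1 (1 - i)| < |v.1 i| → |v.1 (1 - j)| < |v.1 j| → False := by
    intro i j hij v hi hj
    fin_cases i <;> fin_cases j <;> simp at hij hi hj <;> omega
  have hinj : Function.Injective (FreeGroup.lift shearEquiv) := by
    apply FreeGroup.injective_lift_of_ping_pong shearEquiv (α := PrimitiveVector)
      attracting repelling
    · intro i
      let v : PrimitiveVector := ⟨![1, 0], MulAction.mem_orbit_self _⟩
      fin_cases i
      · exact ⟨v, by simp [attracting, v]⟩
      · refine ⟨shearEquiv 1 • v, ?_⟩
        change |(shearEquiv 1 • v).1 0| < |(shearEquiv 1 • v).1 1| ∧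
          0 ≤ (shearEquiv 1 • v).1 0 * (shearEquiv 1 • v).1 1
        rw [smul_val, shearEquiv_one_apply]
        simp [v]
    · intro i j hij
      exact Set.disjoint_left.2 fun v hv hv' => hdisj i j hij v hv.1 hv'.1
    · intro i j hij
      exact Set.disjoint_left.2 fun v hv hv' => hdisj i j hij v hv.1 hv'.1
    · intro i j
      exact Set.disjoint_left.2 fun v hv hv' => not_lt.2 hv.2 hv'.2
    · intro i
      rintro _ ⟨v, hv, rfl⟩
      have hv' : ¬(|v.1 (1 - i)| < |v.1 i| ∧ v.1 0 * v.1 1 < 0) := hv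
      change |(shearEquiv i • v).1 (1 - i)| < |(shearEquiv i • v).1 i| ∧
        0 ≤ (shearEquiv i • v).1 0 * (shearEquiv i • v).1 1
      rw [smul_val]
      fin_cases i
      · have := abs_lt_abs_add hv' v.ne_zero
        simpa [shearEquiv_zero_apply] using this
      · rw [mul_comm] at hv'
        have := abs_lt_abs_add hv' fun h => v.ne_zero h.symm
        simpa [shearEquiv_one_apply, add_comm, mul_comm] using this
    · intro i
      rintro _ ⟨v, hv, rfl⟩
      obtain ⟨w, hw⟩ : ∃ w : PrimitiveVector, w = shearEquiv⁻¹ i • v := ⟨_, rfl⟩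
      have hvw : v = shearEquiv i • w := by rw [hw, Pi.inv_apply, smul_inv_smul]
      have hv' : ¬(|v.1 (1 - i)| < |v.1 i| ∧ 0 ≤ v.1 0 * v.1 1) := hv
      change shearEquiv⁻¹ i • v ∈ repelling i
      rw [← hw]
      change |w.1 (1 - i)| < |w.1 i| ∧ w.1 0 * w.1 1 < 0
      have hval : v.1 = shearEquiv i w.1 := by rw [hvw, smul_val]
      fin_cases i
      · have := abs_lt_abs_sub hv' v.ne_zero
        simpa [hval, shearEquiv_zero_apply] using this
      · rw [mul_comm] at hv'
        have := abs_lt_abs_sub hv' fun h => v.ne_zero h.symm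
        simpa [hval, shearEquiv_one_apply, mul_comm] using this
  -- Ping-pong was played in the group of linear automorphisms; injectivity descends because that
  -- map factors through SL₂(ℤ).
  have hcomp : FreeGroup.lift shearEquiv =
      (Matrix.SpecialLinearGroup.toLin' (n := Fin 2) (R := ℤ)).comp (FreeGroup.lift shear) := by
    ext i
    simp [shearEquiv]
  rw [hcomp, MonoidHom.coe_comp] at hinj
  exact hinj.of_comp

lemma isFreeGroup_unipotentPair_three : IsFreeGroup (Subgroup.closure (unipotentPair 3)) := by
  have hrange : Set.range shear = unipotentPair 3 := by
    ext g
    simp only [Set.mem_range, Fin.exists_fin_two, unipotentPair]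
    simp only [eq_comm]
    exact Iff.rfl
  have e : FreeGroup (Fin 2) ≃* (FreeGroup.lift shear).range :=
    MonoidHom.ofInjective injective_lift_shear
  have hr : (FreeGroup.lift shear).range = Subgroup.closure (unipotentPair 3) := by
    rw [FreeGroup.range_lift_eq_closure, hrange]
  rw [← hr]
  exact IsFreeGroup.ofMulEquiv e

end PingPong

end SLTwoGrowth


/-! ### Assembly of the main theorem -/

open SLTwoGrowth in
theorem mainTheorem5 :
    (∀ A : Set (Matrix.SpecialLinearGroup (Fin 2) ℤ), IsFreeGroup (Subgroup.closure A) →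
      ∃ C : ℝ, 0 < C ∧ ∀ p : ℕ, p.Prime → Subgroup.closure (reductionMod p '' A) = ⊤ →
        (cayleyGraph (reductionMod p '' A)).Connected ∧
        ((cayleyGraph (reductionMod p '' A)).diam : ℝ) ≤ C * Real.log p) ∧
    IsFreeGroup (Subgroup.closure (unipotentPair 3)) ∧
    (∀ m : ℤ, m = 1 ∨ m = 3 →
      (∀ p : ℕ, p.Prime → 5 ≤ p → Subgroup.closure (reductionMod p '' unipotentPair m) = ⊤) ∧
      ∃ C : ℝ, 0 < C ∧ ∀ p : ℕ, p.Prime → 5 ≤ p →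
        (cayleyGraph (reductionMod p '' unipotentPair m)).Connected ∧
        ((cayleyGraph (reductionMod p '' unipotentPair m)).diam : ℝ) ≤ C * Real.log p) := by
  have hgen : ∀ m : ℤ, m = 1 ∨ m = 3 → ∀ p : ℕ, p.Prime → 5 ≤ p →
      Subgroup.closure (reductionMod p '' unipotentPair m) = ⊤ := by
    intro m hm p hp h5
    have : Fact p.Prime := ⟨hp⟩
    apply closure_reductionMod_unipotentPair
    rcases hm with rfl | rfl
    · simp
    · intro h
      have h3 : ((3 : ℕ) : ZMod p) = 0 := by exact_mod_cast h
      rw [ZMod.natCast_eq_zero_iff] at h3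
      exact absurd (Nat.le_of_dvd (by norm_num) h3) (by omega)
  refine ⟨fun A hA => ?_, isFreeGroup_unipotentPair_three, fun m hm => ⟨hgen m hm, ?_⟩⟩
  · obtain ⟨C, hC, h⟩ := exists_symmetrization_pow_eq_univ hA
    refine ⟨C, hC, fun p hp hgenp => ?_⟩
    obtain ⟨N, hN, hpow⟩ := h p ⟨hp⟩ hgenp
    have : Fact p.Prime := ⟨hp⟩
    obtain ⟨hconn, hdiam⟩ := cayleyGraph_diam_le hpow
    exact ⟨hconn, le_trans (by exact_mod_cast hdiam) hN⟩
  · obtain ⟨C, hC, h⟩ := exists_symmetrization_pow_eq_univ isFreeGroup_unipotentPair_three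
    refine ⟨3 * C, by positivity, fun p hp h5 => ?_⟩
    have : Fact p.Prime := ⟨hp⟩
    obtain ⟨N, hN, hpow⟩ := h p ⟨hp⟩ (hgen 3 (Or.inr rfl) p hp h5)
    -- Both values of m are derived from the free case m = 3, at the cost of replacing each letter
    -- by three.
    have hpow' : symmetrization (reductionMod p '' unipotentPair m) ^ (3 * N) = Finset.univ := by
      rw [← Finset.univ_subset_iff, ← hpow, pow_mul]
      apply Finset.pow_subset_pow_left
      rcases hm with rfl | rfl
      · exact symmetrization_unipotentPair_three_subset p
      · exact Finset.subset_pow (one_mem_symmetrization _) (by norm_num)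
    obtain ⟨hconn, hdiam⟩ := cayleyGraph_diam_le hpow'
    refine ⟨hconn, le_trans (Nat.cast_le.2 hdiam) ?_⟩
    push_cast
    linarith
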